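/- **Proposition (hardness of bounded-treewidth iterated matrix multiplication).** There is a constant $w$ such that the following problem $\mathrm{IMM}_w$ is $\mathsf{GapL}$-hard under logspace many-one reductions. Given a sequence $M_1,\dots,M_n$ of square rational matrices of the same size $d\times d$, each of treewidth at most $w$, and $1^i,1^j,1^k$ with $1\le i,j\le d$, compute the $k$-th bit of the $(i,j)$ entry of the product $M_1M_2\cdots M_n$. Here: * The treewidth of a matrix $A$ is that of its underlying undirected graph on $\{1,\dots,d\}$, in which $u\ne v$ are adjacent if and only if $A_{uv}\neq0$ or $A_{vu}\ne 0$. * In the input, rational numbers are written as fractions in lowest terms with numerator and denominator in binary, and the matrices are written entry by entry. * The bits of a rational number $q$ are numbered from $0$: bit $0$ is the sign (it is $1$ if and only if $q<0$), and the following bits are the binary digits of $|q|$ of weights $2^0,2^{-1},2^1,2^{-2},2^2,\dots$, where the digit of weight $2^e$ is $\lfloor |q|/2^e\rfloor \bmod 2$. For an integer $z$, bit $0$ is the sign and bit $p+1$ is the binary digit of $|z|$ of weight $2^p$. * A function $f:\{0,1\}^*\to\mathbb Z$ is in $\mathsf{GapL}$ if there is a nondeterministic logspace Turing machine, all of whose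 computation paths halt, such that for every $x$ the value $f(x)$ is the number of accepting paths minus the number of rejecting paths on input $x$. * $\mathsf{GapL}$-hardness means that for every $f\in\mathsf{GapL}$ there is a logspace-computable function $g$ such that, for all $x\in\{0,1\}^*$ and $k\ge 0$, $g(x,1^k)$ encodes an admissible input of $\mathrm{IMM}_w$ (all its matrices have treewidth at most $w$) whose answer is the $k$-th bit of $f(x)$. -/

import Mathlib

/-! ### Treewidth -/

/-- A tree decomposition of an undirected graph `G`, with nodes in a finite type `ι`. -/
structure TreeDecomposition {V : Type} (G : SimpleGraph V) (ι : Type) where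
  tree : SimpleGraph ι
  isTree : tree.IsTree
  bag : ι → Finset V
  vertex_mem : ∀ v, ∃ t, v ∈ bag t
  edge_mem : ∀ u v, G.Adj u v → ∃ t, u ∈ bag t ∧ v ∈ bag t
  path_mem : ∀ (v : V) (s t : ι), v ∈ bag s → v ∈ bag t →
    ∀ p : tree.Walk s t, p.IsPath → ∀ r ∈ p.support, v ∈ bag r

/-- `G` has treewidth at most `w`: some tree decomposition has all its bags of size at most
`w + 1`. -/
def TreewidthLE {V : Type} (G : SimpleGraph V) (w : ℕ) : Prop :=
  ∃ (ι : Type) (_ : Finite ι) (T : TreeDecomposition G ι), ∀ t, (T.bag t).card ≤ w + 1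

/-- The undirected graph underlying the weighted digraph whose adjacency matrix is `A`
(loops are dropped). -/
def supportGraph {d : ℕ} (A : Matrix (Fin d) (Fin d) ℚ) : SimpleGraph (Fin d) :=
  SimpleGraph.fromRel fun i j => A i j ≠ 0

/-! ### Space-bounded Turing machines

A machine has a read-only two-way input tape with end markers and `k` work tapes, which are
infinite to the right. -/

/-- What the input head sees. -/
inductive InSym (A : Type) : Type
  | leftEnd : InSym A
  | sym (a : A) : InSym A
  | rightEnd : InSym A

/-- Head movements. -/
inductive Dir : Type
  | left | stay | right

/-- The input word `x` occupies the cells `1, …, |x|`; the cells `0` and `|x| + 1` hold the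
end markers. -/
def readInput {A : Type} (x : List A) : ℕ → InSym A
  | 0 => InSym.leftEnd
  | p + 1 => match x[p]? with
    | some a => InSym.sym a
    | none => InSym.rightEnd

/-- Moving a head; a head on cell `0` cannot move further to the left. -/
def Dir.move : Dir → ℕ → ℕ
  | Dir.left, p => p - 1
  | Dir.stay, p => p
  | Dir.right, p => p + 1

/-- A transition: the new state, the movement of the input head, the symbols written on the work
tapes, and the movements of the work heads. -/
structure Transition (Q Γ : Type) (k : ℕ) where
  state : Q
  inDir : Dir
  write : Fin k → Γ
  dir : Fin k → Dir

/-- A configuration (apart from the input, which never changes). -/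
structure Cfg (Q Γ : Type) (k : ℕ) where
  state : Q
  inPos : ℕ
  head : Fin k → ℕ
  tape : Fin k → ℕ → Γ

namespace Cfg

variable {Q Γ : Type} {k : ℕ}

/-- The symbols under the work heads. -/
def scanned (c : Cfg Q Γ k) : Fin k → Γ := fun i => c.tape i (c.head i)

/-- The configuration reached by performing an action on an input of length `n`; the input head
stays between the end markers. -/
def apply (n : ℕ) (c : Cfg Q Γ k) (a : Transition Q Γ k) : Cfg Q Γ k where
  state := a.state
  inPos := min (a.inDir.move c.inPos) (n + 1)
  head := fun i => (a.dir i).move (c.head i)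
  tape := fun i => Function.update (c.tape i) (c.head i) (a.write i)

end Cfg

/-- A nondeterministic machine with input alphabet `A`. A configuration without applicable
transitions is halting; it is accepting or rejecting according to its state. -/
structure NTM (A : Type) where
  Q : Type
  Γ : Type
  finQ : Finite Q
  finΓ : Finite Γ
  k : ℕ
  start : Q
  blank : Γ
  accept : Q → Bool
  δ : Q → InSym A → (Fin k → Γ) → Finset (Transition Q Γ k)

namespace NTM

variable {A : Type} (M : NTM A)

/-- The initial configuration. -/
def init : Cfg M.Q M.Γ M.k := ⟨M.start, 0, fun _ => 0, fun _ _ => M.blank⟩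

/-- The transitions applicable in a configuration on input `x`. -/
def next (x : List A) (c : Cfg M.Q M.Γ M.k) : Finset (Transition M.Q M.Γ M.k) :=
  M.δ c.state (readInput x c.inPos) c.scanned

/-- One step of a computation on input `x`. -/
def Step (x : List A) (c c' : Cfg M.Q M.Γ M.k) : Prop :=
  ∃ a ∈ M.next x c, c' = c.apply x.length a

/-- On every input of length `n`, along all computation paths, the work heads stay within the
first `O(log n)` cells. -/
def IsLogspace : Prop :=
  ∃ C : ℕ, ∀ (x : List A) (c : Cfg M.Q M.Γ M.k), Relation.ReflTransGen (M.Step x) M.init c →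
    ∀ i, c.head i ≤ C * Nat.log 2 x.length + C

/-- Every computation path from `c` halts within `t` steps. -/
def HaltsIn (x : List A) : ℕ → Cfg M.Q M.Γ M.k → Prop
  | 0, c => M.next x c = ∅
  | t + 1, c => ∀ a ∈ M.next x c, HaltsIn x t (c.apply x.length a)

open Classical in
/-- The number of computation paths from `c` that halt within `t` steps and are accepting
(if `b = true`) or rejecting (if `b = false`). -/
noncomputable def numPaths (x : List A) (b : Bool) : ℕ → Cfg M.Q M.Γ M.k → ℕ
  | 0, c => if M.next x c = ∅ ∧ M.accept c.state = b then 1 else 0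
  | t + 1, c =>
    if M.next x c = ∅ then (if M.accept c.state = b then 1 else 0)
    else ∑ a ∈ M.next x c, numPaths x b t (c.apply x.length a)

end NTM

/-- `f` is in `GapL`: there is a nondeterministic logspace machine, all of whose computation paths
halt, such that `f x` is the number of accepting paths minus the number of rejecting paths on
input `x`. -/
def IsGapL (f : List Bool → ℤ) : Prop :=
  ∃ M : NTM Bool, M.IsLogspace ∧ ∀ x, ∃ T, M.HaltsIn x T M.init ∧
    f x = (M.numPaths x true T M.init : ℤ) - (M.numPaths x false T M.init : ℤ)

/-- A deterministic machine with input alphabet `A` and a write-only output tape over `B`; each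
step appends at most one symbol to the output. It halts when no transition is applicable. -/
structure Transducer (A B : Type) where
  Q : Type
  Γ : Type
  finQ : Finite Q
  finΓ : Finite Γ
  k : ℕ
  start : Q
  blank : Γ
  δ : Q → InSym A → (Fin k → Γ) → Option (Transition Q Γ k × Option B)

namespace Transducer

variable {A B : Type} (M : Transducer A B)

/-- The initial configuration, with empty output. -/
def init : Cfg M.Q M.Γ M.k × List B := (⟨M.start, 0, fun _ => 0, fun _ _ => M.blank⟩, [])

/-- The next configuration and output on input `x`, if the machine has not halted. -/
def step (x : List A) (c : Cfg M.Q M.Γ M.k × List B) : Option (Cfg M.Q M.Γ M.k × List B) :=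
  (M.δ c.1.state (readInput x c.1.inPos) c.1.scanned).map fun a =>
    (c.1.apply x.length a.1, c.2 ++ a.2.toList)

/-- Reachability on input `x`. -/
def Reaches (x : List A) (c c' : Cfg M.Q M.Γ M.k × List B) : Prop :=
  Relation.ReflTransGen (fun e e' => M.step x e = some e') c c'

/-- The work heads stay within the first `O(log n)` cells on every input of length `n`. -/
def IsLogspace : Prop :=
  ∃ C : ℕ, ∀ (x : List A) (c : Cfg M.Q M.Γ M.k × List B), M.Reaches x M.init c →
    ∀ i, c.1.head i ≤ C * Nat.log 2 x.length + C

/-- On every input `x` the machine halts with output `g x`. -/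
def Computes (g : List A → List B) : Prop :=
  ∀ x, ∃ c, M.Reaches x M.init c ∧ M.step x c = none ∧ c.2 = g x

end Transducer

/-- `g` is computable in logarithmic space. -/
def LogspaceComputable {A B : Type} (g : List A → List B) : Prop :=
  ∃ M : Transducer A B, M.IsLogspace ∧ M.Computes g

/-! ### Hardness for `GapL` -/

/-- The bits of an integer in sign-magnitude form: bit `0` is the sign (`true` for negative
integers), bit `p + 1` is the binary digit of `|z|` of weight `2 ^ p`. -/
def intBit (z : ℤ) : ℕ → Bool
  | 0 => decide (z < 0)
  | p + 1 => z.natAbs.testBit p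

/-- The word that encodes the pair `(x, 1ᵏ)`. -/
def pairWord (x : List Bool) (k : ℕ) : List (Option Bool) :=
  x.map some ++ List.replicate k none

/-- Let `P` be a computational problem with answers in `{0,1}`, where `P s b` says that `s` encodes
an admissible input with answer `b`. It is `GapL`-hard (under logspace many-one reductions) if for
every `f` in `GapL` the task of computing the `k`-th bit of `f x` from `(x, 1ᵏ)` reduces to it. -/
def GapLHard {B : Type} (P : List B → Bool → Prop) : Prop :=
  ∀ f : List Bool → ℤ, IsGapL f →
    ∃ g : List (Option Bool) → List B, LogspaceComputable g ∧
      ∀ x k, P (g (pairWord x k)) (intBit (f x) k)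

/-! ### Iterated matrix multiplication -/

/-- The binary digit of `|q|` of weight `2 ^ e`, for `e : ℤ`. -/
def ratDigit (q : ℚ) (e : ℤ) : Bool := decide (Odd ⌊|q| / (2 : ℚ) ^ e⌋)

/-- The bits of a rational number, listed as: the sign (`true` for negative numbers), followed by
the binary digits of `|q|` of weights `2 ^ 0, 2 ^ (-1), 2 ^ 1, 2 ^ (-2), 2 ^ 2, …`. -/
def ratBit (q : ℚ) : ℕ → Bool
  | 0 => decide (q < 0)
  | p + 1 => if p % 2 = 0 then ratDigit q ((p / 2 : ℕ) : ℤ) else ratDigit q (-((p / 2 : ℕ) : ℤ) - 1)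

/-- An input: square rational matrices of the same size, row and column indices, and the index of
a bit. -/
structure IMMInput where
  d : ℕ
  mats : List (Matrix (Fin d) (Fin d) ℚ)
  i : Fin d
  j : Fin d
  k : ℕ

/-- The alphabet in which inputs are written. -/
inductive IMMSym : Type
  | zero | one | minus | slash | comma | semicolon | bar
  deriving DecidableEq

/-- Binary notation, most significant digit first (`0` is the empty word). -/
def encNat (n : ℕ) : List IMMSym := (n.bits.map fun b => if b then IMMSym.one else IMMSym.zero).reverse

/-- Unary notation, terminated by a semicolon. -/
def encUnary (n : ℕ) : List IMMSym := List.replicate n IMMSym.one ++ [IMMSym.semicolon]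

/-- A rational number in lowest terms, terminated by a comma. -/
def encRat (q : ℚ) : List IMMSym :=
  (if q < 0 then [IMMSym.minus] else []) ++ encNat q.num.natAbs ++ [IMMSym.slash] ++ encNat q.den ++
    [IMMSym.comma]

/-- A row of a matrix, terminated by a semicolon. -/
def encRow {d : ℕ} (v : Fin d → ℚ) : List IMMSym :=
  (List.ofFn fun j => encRat (v j)).flatten ++ [IMMSym.semicolon]

/-- A matrix, row by row, preceded by a bar. -/
def encMat {d : ℕ} (A : Matrix (Fin d) (Fin d) ℚ) : List IMMSym :=
  IMMSym.bar :: (List.ofFn fun i => encRow (A i)).flatten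

/-- The word that encodes an input; the dimension, `i`, `j` (counted from `1`) and `k` are in
unary, the entries of the matrices in binary. -/
def IMMInput.encode (I : IMMInput) : List IMMSym :=
  encUnary I.d ++ (I.mats.map encMat).flatten ++
    encUnary (I.i + 1) ++ encUnary (I.j + 1) ++ encUnary I.k

/-- Iterated multiplication of matrices of treewidth at most `w`: given `M₁, …, Mₙ` and
`1ⁱ, 1ʲ, 1ᵏ`, compute the `k`-th bit of the `(i, j)` entry of `M₁ ⋯ Mₙ`. -/
def immBit (w : ℕ) (s : List IMMSym) (b : Bool) : Prop :=
  ∃ I : IMMInput, I.encode = s ∧ (∀ A ∈ I.mats, TreewidthLE (supportGraph A) w) ∧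
    ratBit (I.mats.prod I.i I.j) I.k = b

theorem append_cons_inj_of_notMem {α : Type} {a : α} {l l' r r' : List α} (h : a ∉ l) (h' : a ∉ l')
    (e : l ++ a :: r = l' ++ a :: r') : l = l' ∧ r = r' := by
  induction l generalizing l' with
  | nil =>
    cases l' with
    | nil => exact ⟨rfl, by simpa using e⟩
    | cons c l' =>
      simp only [List.nil_append, List.cons_append, List.cons.injEq] at e
      exact absurd (e.1 ▸ List.mem_cons_self) h'
  | cons b l ih =>
    cases l' with
    | nil =>
      simp only [List.nil_append, List.cons_append, List.cons.injEq] at e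
      exact absurd (e.1 ▸ List.mem_cons_self) h
    | cons c l' =>
      simp only [List.mem_cons, not_or] at h h'
      simp only [List.cons_append, List.cons.injEq] at e
      obtain ⟨h1, h2⟩ := ih h.2 h'.2 e.2
      exact ⟨by rw [e.1, h1], h2⟩

theorem encNat_notMem (n : ℕ) {s : IMMSym} (h0 : s ≠ .zero) (h1 : s ≠ .one) : s ∉ encNat n := by
  simp only [encNat, List.mem_reverse, List.mem_map, not_exists, not_and]
  intro b _ hb
  cases b <;> simp_all

theorem encNat_injective : Function.Injective encNat := by
  intro m n h
  have hf : Function.Injective fun b : Bool => if b then IMMSym.one else IMMSym.zero := by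
    intro a b; cases a <;> cases b <;> simp
  have h' := hf.list_map (List.reverse_injective h)
  have hd : Nat.digits 2 m = Nat.digits 2 n := by
    rw [Nat.digits_two_eq_bits, Nat.digits_two_eq_bits, h']
  exact Nat.digits_inj_iff.1 hd

theorem encUnary_append_inj {m n : ℕ} {r s : List IMMSym}
    (h : encUnary m ++ r = encUnary n ++ s) : m = n ∧ r = s := by
  simp only [encUnary, List.append_assoc, List.cons_append, List.nil_append] at h
  have := append_cons_inj_of_notMem (by simp [List.mem_replicate])
    (by simp [List.mem_replicate]) h
  exact ⟨by simpa using congrArg List.length this.1, this.2⟩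

theorem encRat_append_inj {p q : ℚ} {r s : List IMMSym}
    (h : encRat p ++ r = encRat q ++ s) : p = q ∧ r = s := by
  simp only [encRat, List.append_assoc, List.cons_append, List.nil_append] at h
  rw [← List.append_assoc, ← List.append_assoc (if q < 0 then _ else _)] at h
  have hs : ∀ q : ℚ, IMMSym.slash ∉ (if q < 0 then [IMMSym.minus] else []) ++
      encNat q.num.natAbs := by
    intro q
    have := encNat_notMem q.num.natAbs (s := .slash) (by simp) (by simp)
    split_ifs <;> simp [this]
  obtain ⟨h1, h2⟩ := append_cons_inj_of_notMem (hs p) (hs q) h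
  obtain ⟨h3, h4⟩ := append_cons_inj_of_notMem
    (encNat_notMem _ (by simp) (by simp)) (encNat_notMem _ (by simp) (by simp)) h2
  refine ⟨?_, h4⟩
  have hm := fun q : ℚ => encNat_notMem q.num.natAbs (s := .minus) (by simp) (by simp)
  have key : ((p < 0) ↔ (q < 0)) ∧ encNat p.num.natAbs = encNat q.num.natAbs := by
    have hp := hm p
    have hq := hm q
    by_cases a : p < 0 <;> by_cases b : q < 0 <;> simp only [a, b, if_true, if_false] at h1
    · exact ⟨by simp [a, b], by simpa using h1⟩
    · exact absurd (by rw [← List.nil_append (encNat _), ← h1]; simp) hq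
    · exact absurd (by rw [← List.nil_append (encNat _), h1]; simp) hp
    · exact ⟨by simp [a, b], by simpa using h1⟩
  have hn := encNat_injective key.2
  refine Rat.ext ?_ (encNat_injective h3)
  have hk := key.1
  rw [← Rat.num_neg, ← Rat.num_neg] at hk
  omega

theorem flatten_ofFn_append_inj {α β : Type} {e : α → List β}
    (he : ∀ {a b r s}, e a ++ r = e b ++ s → a = b ∧ r = s) {n : ℕ} {v w : Fin n → α}
    {r s : List β} (h : (List.ofFn fun j => e (v j)).flatten ++ r =
      (List.ofFn fun j => e (w j)).flatten ++ s) : v = w ∧ r = s := by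
  induction n with
  | zero => exact ⟨Subsingleton.elim _ _, by simpa using h⟩
  | succ n ih =>
    simp only [List.ofFn_succ, List.flatten_cons, List.append_assoc] at h
    obtain ⟨h0, h1⟩ := he h
    obtain ⟨h2, h3⟩ := ih (v := fun j => v j.succ) (w := fun j => w j.succ) h1
    refine ⟨funext fun j => ?_, h3⟩
    cases j using Fin.cases with
    | zero => exact h0
    | succ j => exact congrFun h2 j

theorem encRow_append_inj {d : ℕ} {v w : Fin d → ℚ} {r s : List IMMSym}
    (h : encRow v ++ r = encRow w ++ s) : v = w ∧ r = s := by
  simp only [encRow, List.append_assoc] at h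
  obtain ⟨h1, h2⟩ := flatten_ofFn_append_inj encRat_append_inj h
  exact ⟨h1, by simpa using h2⟩

theorem encMat_append_inj {d : ℕ} {A B : Matrix (Fin d) (Fin d) ℚ} {r s : List IMMSym}
    (h : encMat A ++ r = encMat B ++ s) : A = B ∧ r = s := by
  simp only [encMat, List.cons_append, List.cons.injEq, true_and] at h
  exact flatten_ofFn_append_inj encRow_append_inj h

theorem flatten_encMat_append_inj {d m n : ℕ} {l l' : List (Matrix (Fin d) (Fin d) ℚ)}
    {r s : List IMMSym} (h : (l.map encMat).flatten ++ (encUnary m ++ r) =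
      (l'.map encMat).flatten ++ (encUnary n ++ s)) :
    l = l' ∧ encUnary m ++ r = encUnary n ++ s := by
  have hb : ∀ (A : Matrix (Fin d) (Fin d) ℚ) (m : ℕ) (r t : List IMMSym),
      encUnary m ++ r ≠ encMat A ++ t := by
    intro A m r t h
    cases m <;> simp [encUnary, encMat, List.replicate_succ] at h
  induction l generalizing l' with
  | nil =>
    cases l' with
    | nil => exact ⟨rfl, by simpa using h⟩
    | cons A l' => exact absurd (by simpa using h) (hb A m r _)
  | cons A l ih =>
    cases l' with
    | nil => exact absurd (by simpa using h.symm) (hb A n s _)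
    | cons B l' =>
      simp only [List.map_cons, List.flatten_cons, List.append_assoc] at h
      obtain ⟨h1, h2⟩ := encMat_append_inj h
      obtain ⟨h3, h4⟩ := ih h2
      exact ⟨by rw [h1, h3], h4⟩

/-- Different inputs have different encodings, so `immBit w s` holds for at most one bit. -/
theorem IMMInput.encode_injective : Function.Injective IMMInput.encode := by
  rintro ⟨d, l, i, j, k⟩ ⟨d', l', i', j', k'⟩ h
  simp only [IMMInput.encode, List.append_assoc] at h
  obtain ⟨rfl, h1⟩ := encUnary_append_inj h
  obtain ⟨rfl, h2⟩ := flatten_encMat_append_inj h1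
  obtain ⟨hi, h3⟩ := encUnary_append_inj h2
  obtain ⟨hj, h4⟩ := encUnary_append_inj h3
  rw [← List.append_nil (encUnary k), ← List.append_nil (encUnary k')] at h4
  obtain ⟨rfl, -⟩ := encUnary_append_inj h4
  obtain rfl : i = i' := Fin.ext (by omega)
  obtain rfl : j = j' := Fin.ext (by omega)
  rfl

/-!
The constant is `w = 1`: matrices that differ from the identity in a single row are already hard.

Let `f` count the accepting minus the rejecting paths of a nondeterministic logspace machine `M`.
The value of a configuration is the number of accepting minus rejecting paths that start in it; it
is `±1` for a halting configuration, and otherwise the sum of the values of the successors.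
Configurations are coded by numbers below a bound `N` that is polynomial in the length of the input,
and one more index, which codes no configuration, collects the results. The matrix of an index `a`
(`Branching.rowMatrix`) is the identity, except that its row `a` lists the successors of the
configuration with the code `a`, or the sign `±1` in the collecting column if this configuration
halts. The product of a row vector with this matrix moves the weight of `a` to the successors of
`a`. This does not change the total value of the vector (`Branching.rowMatrix_mulVec`), and after a
round through all the indices every unfinished branch has become shorter by at least one step
(`Branching.vecMul_round`). A branch that ends cannot visit a configuration twice, so it has fewer
than `N` steps (`Branching.HaltsIn.exists_lt`), and `N` rounds move all the weight to the collecting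
index. Thus the entry of the product at the initial configuration and the collecting index is `f x`
(`Branching.prod_matrices_apply`, `CfgCode.prod_matrices_eq`). The graph of each factor is a star,
up to isolated vertices, and has treewidth at most one (`Branching.treewidthLE_rowMatrix`). Bit `k`
of an integer is bit `2 k - 1` of this integer as a rational number (`ratBit_intCast`).

The codes of configurations are chosen so that transitions act on them by arithmetic. The digits of
a code, in a base that is a power of the length of the input, are the state, the position of the
input head, and for each work tape two numbers that describe the cells to the left of the head and
the remaining cells (`CfgCode.Codes.apply`).

It remains to write down the matrices in logarithmic space. A register machine whose registers stay
polynomially bounded is simulated by a logspace transducer that keeps each register in binary on a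
work tape of its own (`RegMachine.logspaceComputable_of_program`). The functions that structured
programs compute on such machines are closed under bounded summation and case distinction, hence
under arithmetic (`RegMachine.RegComputable`), and the words they print are closed under
concatenation over bounded variables (`RegMachine.RegOutput`). The encoding of the matrices is
built with these closure properties (`CfgCode.logspaceComputable_instanceWord`).
-/

/-! ### Register machines -/

namespace RegMachine

open Relation

/-- The unconditional instructions of a register machine: increment a register, clear a register,
move the input head to the left end marker, move it one cell to the right, output a symbol. -/
inductive Act (B : Type) : Type
  | inc (i : ℕ)
  | clr (i : ℕ)
  | home
  | right
  | out (b : B)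

/-- The tests of a register machine: compare two registers, or test the scanned input symbol. -/
inductive Cond (A : Type) : Type
  | lt (i j : ℕ)
  | inp (P : InSym A → Bool)

/-- Instructions with jumps to control states in `Q`. -/
inductive Instr (A B Q : Type) : Type
  | act (a : Act B) (q : Q)
  | branch (c : Cond A) (q q' : Q)
  | halt

/-- The data of a register machine: the contents of the registers, the position of the input head
and the output produced so far. -/
structure State (B : Type) where
  reg : ℕ → ℕ
  pos : ℕ
  output : List B

variable {A B Q : Type}

/-- The effect of an instruction on an input of length `n`. Incrementing is only possible as long
as the register stays at most `G`; this guard carries the space bound through all later proofs. -/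
def Act.run (n G : ℕ) (s : State B) : Act B → Option (State B)
  | inc i => if s.reg i < G then
      some ⟨Function.update s.reg i (s.reg i + 1), s.pos, s.output⟩ else none
  | clr i => some ⟨Function.update s.reg i 0, s.pos, s.output⟩
  | home => some ⟨s.reg, 0, s.output⟩
  | right => some ⟨s.reg, min (s.pos + 1) (n + 1), s.output⟩
  | out b => some ⟨s.reg, s.pos, s.output ++ [b]⟩

/-- The outcome of a test. -/
def Cond.eval (x : List A) (s : State B) : Cond A → Bool
  | lt i j => decide (s.reg i < s.reg j)
  | inp P => P (readInput x s.pos)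

/-- One step of a register machine. -/
def Instr.exec (x : List A) (G : ℕ) (s : State B) : Instr A B Q → Option (Q × State B)
  | act a q => (a.run x.length G s).map fun s' => (q, s')
  | branch c q q' => some (if c.eval x s then q else q', s)
  | halt => none

/-- One step of the program `prog`. -/
def Step (prog : Q → Instr A B Q) (x : List A) (G : ℕ) (c c' : Q × State B) : Prop :=
  (prog c.1).exec x G c.2 = some c'

/-- All registers that occur in the instruction are smaller than `R`. -/
def Instr.RegsLT (R : ℕ) : Instr A B Q → Prop
  | act (.inc i) _ => i < R
  | act (.clr i) _ => i < R
  | branch (.lt i j) _ _ => i < R ∧ j < R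
  | _ => True

theorem Instr.exists_regsLT (I : Instr A B Q) : ∃ R, ∀ R', R ≤ R' → I.RegsLT R' := by
  rcases I with ⟨a, q⟩ | ⟨c, q, q'⟩ | _
  · cases a with
    | inc i => exact ⟨i + 1, fun R h => by simpa [Instr.RegsLT] using h⟩
    | clr i => exact ⟨i + 1, fun R h => by simpa [Instr.RegsLT] using h⟩
    | _ => exact ⟨0, fun _ _ => trivial⟩
  · cases c with
    | lt i j =>
      refine ⟨i + j + 1, fun R h => ?_⟩
      simp only [Instr.RegsLT]
      omega
    | _ => exact ⟨0, fun _ _ => trivial⟩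
  · exact ⟨0, fun _ _ => trivial⟩

theorem exists_regsLT [Finite Q] (prog : Q → Instr A B Q) : ∃ R, ∀ q, (prog q).RegsLT R := by
  choose f hf using fun q => (prog q).exists_regsLT
  obtain ⟨R, hR⟩ := (Set.finite_range f).bddAbove
  exact ⟨R, fun q => hf q R (hR ⟨q, rfl⟩)⟩

/-! ### Binary counters on work tapes -/

/-- A cell of a work tape: blank, or a binary digit that may carry a mark. Register contents are
written in binary, least significant digit first; only the cell `0` is ever marked, so that the
head finds its way back. -/
abbrev Cell : Type := Option (Bool × Bool)

/-- The digit in a cell; a blank counts as `0`. -/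
def bit : Cell → Bool
  | some (_, b) => b
  | none => false

/-- Whether the cell is marked. -/
def marked : Cell → Bool
  | some (m, _) => m
  | none => false

/-- Marking a cell. -/
def mark (c : Cell) : Cell := some (true, bit c)

@[simp] theorem bit_some (m b : Bool) : bit (some (m, b)) = b := rfl
@[simp] theorem bit_none : bit none = false := rfl
@[simp] theorem marked_some (m b : Bool) : marked (some (m, b)) = m := rfl
@[simp] theorem marked_none : marked none = false := rfl
@[simp] theorem bit_mark (c : Cell) : bit (mark c) = bit c := rfl
@[simp] theorem marked_mark (c : Cell) : marked (mark c) = true := rfl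

/-- The number written in the first `K` cells. -/
def tapeVal (K : ℕ) (t : ℕ → Cell) : ℕ := ∑ j ∈ Finset.range K, if bit (t j) then 2 ^ j else 0

theorem tapeVal_succ (K : ℕ) (t : ℕ → Cell) :
    tapeVal (K + 1) t = tapeVal K t + if bit (t K) then 2 ^ K else 0 :=
  Finset.sum_range_succ _ _

theorem tapeVal_lt (K : ℕ) (t : ℕ → Cell) : tapeVal K t < 2 ^ K := by
  induction K with
  | zero => simp [tapeVal]
  | succ K ih => rw [tapeVal_succ, pow_succ]; split_ifs <;> omega

theorem tapeVal_congr {K : ℕ} {t t' : ℕ → Cell} (h : ∀ j, bit (t j) = bit (t' j)) :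
    tapeVal K t = tapeVal K t' := by simp [tapeVal, h]

theorem tapeVal_update {K h : ℕ} (hK : h < K) (t : ℕ → Cell) (a : Cell) :
    tapeVal K (Function.update t h a) + (if bit (t h) then 2 ^ h else 0) =
      tapeVal K t + if bit a then 2 ^ h else 0 := by
  have e : ∀ t : ℕ → Cell, tapeVal K t = (if bit (t h) then 2 ^ h else 0) +
      ∑ j ∈ (Finset.range K).erase h, if bit (t j) then 2 ^ j else 0 := fun t =>
    (Finset.add_sum_erase _ _ (Finset.mem_range.2 hK)).symm
  have e' : ∑ j ∈ (Finset.range K).erase h, (if bit (Function.update t h a j) then 2 ^ j else 0) =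
      ∑ j ∈ (Finset.range K).erase h, if bit (t j) then 2 ^ j else 0 :=
    Finset.sum_congr rfl fun j hj => by rw [Function.update_of_ne (Finset.ne_of_mem_erase hj)]
  rw [e (Function.update t h a), e t, e', Function.update_self]
  omega

theorem tapeVal_eq_of_blank {h K : ℕ} {t : ℕ → Cell} (hb : ∀ j, h ≤ j → t j = none) (hK : h ≤ K) :
    tapeVal K t = tapeVal h t := by
  induction K, hK using Nat.le_induction with
  | base => rfl
  | succ K hK ih => simp [tapeVal_succ, hb K hK, ih]

/-- A tape whose written part is an initial segment of the first `K` cells, with no marks except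
possibly on the cell `0`. -/
structure TapeOk (K : ℕ) (t : ℕ → Cell) : Prop where
  mark : ∀ j, marked (t (j + 1)) = false
  blank : ∀ j, t j = none → t (j + 1) = none
  bound : ∀ j, K ≤ j → t j = none

theorem TapeOk.blank_of_le {K : ℕ} {t : ℕ → Cell} (ht : TapeOk K t) {h j : ℕ} (hj : h ≤ j)
    (hb : t h = none) : t j = none := by
  induction j, hj using Nat.le_induction with
  | base => exact hb
  | succ j _ ih => exact ht.blank j ih

/-- Writing a non-blank symbol within or directly behind the written part. -/
theorem TapeOk.update_some {K : ℕ} {t : ℕ → Cell} (ht : TapeOk K t) {h : ℕ} (hK : h < K)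
    {a : Bool × Bool} (ha : a.1 = true → h = 0) (hp : ∀ j < h, t j ≠ none) :
    TapeOk K (Function.update t h (some a)) := by
  obtain ⟨m, b⟩ := a
  refine ⟨fun j => ?_, fun j hj => ?_, fun j hj => ?_⟩
  · by_cases e : j + 1 = h
    · subst e
      simpa using ha
    · rw [Function.update_of_ne e]; exact ht.mark j
  · by_cases e : j = h
    · subst e; simp at hj
    · rw [Function.update_of_ne e] at hj
      have : j + 1 ≠ h := fun e' => hp j (by omega) hj
      rw [Function.update_of_ne this]
      exact ht.blank j hj
  · rw [Function.update_of_ne (by omega)]; exact ht.bound j hj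

/-! ### From register machines to logspace transducers -/

/-- The phase of the execution of an instruction on the work tapes: at its start, all heads are on
the cell `0`; then they sweep to the right and return. The flag is the result of a comparison. -/
inductive Phase : Type
  | start
  | fwd (f : Bool)
  | back (f : Bool)

instance : Finite Phase :=
  Finite.of_injective
    (fun p : Phase => match p with
      | .start => (none : Option (Bool × Bool))
      | .fwd f => some (false, f)
      | .back f => some (true, f))
    (by rintro (_ | _ | _) (_ | _ | _) <;> simp)

/-- A transition that treats all the tapes in `D` alike: it writes `w c` over `c` and moves the
head in direction `d`. The other tapes are left alone. -/
def sweep {R : ℕ} (q : Q × Phase) (D : ℕ → Bool) (w : Cell → Cell) (d : Dir) (σ : Fin R → Cell) :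
    Transition (Q × Phase) Cell R :=
  ⟨q, .stay, fun j => if D j then w (σ j) else σ j, fun j => if D j then d else .stay⟩

/-- A transition that only moves the input head. -/
def moveInput {R : ℕ} (q : Q × Phase) (d : Dir) (σ : Fin R → Cell) :
    Transition (Q × Phase) Cell R :=
  ⟨q, d, σ, fun _ => .stay⟩

/-- The symbol on the tape `i`. -/
def readTape {R : ℕ} (σ : Fin R → Cell) (i : ℕ) : Cell := if h : i < R then σ ⟨i, h⟩ else none

/-- Returning to the cell `0` of the tapes in `D`, and then to the control state `q'`. -/
def sweepBack {R : ℕ} (q q' : Q) (f : Bool) (i : ℕ) (D : ℕ → Bool) (σ : Fin R → Cell) :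
    Transition (Q × Phase) Cell R :=
  if marked (readTape σ i) then sweep (q', .start) D id .stay σ
  else sweep (q, .back f) D id .left σ

/-- The comparison of two binary numbers after one more digit. -/
def cmpStep (f b b' : Bool) : Bool := if b = b' then f else b'

/-- The transition function of the transducer that runs `prog`. -/
def delta (R : ℕ) (prog : Q → Instr A B Q) :
    Q × Phase → InSym A → (Fin R → Cell) → Option (Transition (Q × Phase) Cell R × Option B) :=
  fun p a σ => match prog p.1, p.2 with
  | .halt, _ => none
  | .act (.out b) q', _ => some (moveInput (q', .start) .stay σ, some b)
  | .act .home q', _ => match a with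
    | .leftEnd => some (moveInput (q', .start) .stay σ, none)
    | _ => some (moveInput (p.1, .start) .left σ, none)
  | .act .right q', _ => some (moveInput (q', .start) .right σ, none)
  | .branch (.inp P) q q', _ =>
    some (moveInput (if P a then q else q', .start) .stay σ, none)
  | .act (.inc i) q', .start =>
    if bit (readTape σ i) then
      some (sweep (p.1, .fwd false) (· = i) (fun _ => some (true, false)) .right σ, none)
    else some (sweep (q', .start) (· = i) (fun _ => some (true, true)) .stay σ, none)
  | .act (.inc i) _, .fwd _ =>
    if bit (readTape σ i) then
      some (sweep (p.1, .fwd false) (· = i) (fun _ => some (false, false)) .right σ, none)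
    else some (sweep (p.1, .back false) (· = i) (fun _ => some (false, true)) .left σ, none)
  | .act (.inc i) q', .back f => some (sweepBack p.1 q' f i (· = i) σ, none)
  | .act (.clr i) _, .start =>
    some (sweep (p.1, .fwd false) (· = i) (fun _ => some (true, false)) .right σ, none)
  | .act (.clr i) _, .fwd _ =>
    if readTape σ i = none then some (sweep (p.1, .back false) (· = i) id .left σ, none)
    else some (sweep (p.1, .fwd false) (· = i) (fun _ => none) .right σ, none)
  | .act (.clr i) q', .back f => some (sweepBack p.1 q' f i (· = i) σ, none)
  | .branch (.lt i j) _ _, .start =>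
    some (sweep (p.1, .fwd (cmpStep false (bit (readTape σ i)) (bit (readTape σ j))))
      (fun l => l = i ∨ l = j) mark .right σ, none)
  | .branch (.lt i j) _ _, .fwd f =>
    if readTape σ i = none ∧ readTape σ j = none then
      some (sweep (p.1, .back f) (fun l => l = i ∨ l = j) id .left σ, none)
    else some (sweep (p.1, .fwd (cmpStep f (bit (readTape σ i)) (bit (readTape σ j))))
      (fun l => l = i ∨ l = j) id .right σ, none)
  | .branch (.lt i j) q q', .back f =>
    some (sweepBack p.1 (if f then q else q') f i (fun l => l = i ∨ l = j) σ, none)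

/-- The transducer that runs `prog`, with one work tape for each of the registers `0, …, R - 1`. -/
def transducer [Finite Q] (R : ℕ) (prog : Q → Instr A B Q) (q0 : Q) : Transducer A B where
  Q := Q × Phase
  Γ := Cell
  finQ := inferInstance
  finΓ := inferInstance
  k := R
  start := (q0, .start)
  blank := none
  δ := delta R prog

/-- The configuration in which the heads of the tapes in `D` are on the cell `h` and the others are
on the cell `0`. -/
def cfg (R : ℕ) (p : Q × Phase) (pos h : ℕ) (D : ℕ → Bool) (T : ℕ → ℕ → Cell) :
    Cfg (Q × Phase) Cell R :=
  ⟨p, pos, fun j => if D j then h else 0, fun j => T j⟩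

theorem cfg_zero (R : ℕ) (p : Q × Phase) (pos : ℕ) (D D' : ℕ → Bool) (T : ℕ → ℕ → Cell) :
    cfg R p pos 0 D T = cfg R p pos 0 D' T := by simp [cfg]

theorem readTape_cfg {R : ℕ} {p : Q × Phase} {pos h : ℕ} {D : ℕ → Bool} {T : ℕ → ℕ → Cell} {i : ℕ}
    (hi : i < R) (hD : D i = true) : readTape (cfg R p pos h D T).scanned i = T i h := by
  simp [readTape, hi, cfg, Cfg.scanned, hD]

theorem apply_sweep {R n : ℕ} {p p' : Q × Phase} {pos h : ℕ} {D : ℕ → Bool} {T : ℕ → ℕ → Cell}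
    {w : Cell → Cell} {d : Dir} (hpos : pos ≤ n + 1) :
    (cfg R p pos h D T).apply n (sweep p' D w d (cfg R p pos h D T).scanned) =
      cfg R p' pos (d.move h) D
        (fun j => if D j then Function.update (T j) h (w (T j h)) else T j) := by
  simp only [cfg, Cfg.apply, sweep, Cfg.scanned, Dir.move, Cfg.mk.injEq, true_and]
  refine ⟨by simpa using hpos, ?_, ?_⟩
  · funext j
    by_cases hj : D j <;> simp [hj]
  · funext j
    by_cases hj : D j <;> simp [hj]

theorem apply_sweep_id {R n : ℕ} {p p' : Q × Phase} {pos h : ℕ} {D : ℕ → Bool} {T : ℕ → ℕ → Cell}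
    {d : Dir} (hpos : pos ≤ n + 1) :
    (cfg R p pos h D T).apply n (sweep p' D id d (cfg R p pos h D T).scanned) =
      cfg R p' pos (d.move h) D T := by
  rw [apply_sweep hpos]
  simp

theorem apply_sweep_single {R n : ℕ} {p p' : Q × Phase} {pos h i : ℕ} {T : ℕ → ℕ → Cell}
    {t : ℕ → Cell} {w : Cell → Cell} {d : Dir} (hpos : pos ≤ n + 1) :
    (cfg R p pos h (· = i) (Function.update T i t)).apply n
        (sweep p' (· = i) w d (cfg R p pos h (· = i) (Function.update T i t)).scanned) =
      cfg R p' pos (d.move h) (· = i)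
        (Function.update T i (Function.update t h (w (t h)))) := by
  rw [apply_sweep hpos]
  congr 1
  funext j
  by_cases hj : j = i
  · subst hj; simp
  · simp [hj]

theorem apply_moveInput {R n : ℕ} {p p' : Q × Phase} {pos : ℕ} {D : ℕ → Bool}
    {T : ℕ → ℕ → Cell} {d : Dir} :
    (cfg R p pos 0 D T).apply n (moveInput p' d (cfg R p pos 0 D T).scanned) =
      cfg R p' (min (d.move pos) (n + 1)) 0 D T := by
  simp [cfg, Cfg.apply, moveInput, Cfg.scanned, Dir.move]

section Simulation

variable [Finite Q] {R K : ℕ} {prog : Q → Instr A B Q} {q0 q q' q'' : Q} {x : List A}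

/-- Runs of the transducer along which the work heads stay within the cells `0, …, K`. -/
def BddReach (R K : ℕ) (prog : Q → Instr A B Q) (q0 : Q) (x : List A)
    (c c' : Cfg (Q × Phase) Cell R × List B) : Prop :=
  ReflTransGen (fun e e' : Cfg (Q × Phase) Cell R × List B =>
    (transducer R prog q0).step x e = some e' ∧ ∀ i, e.1.head i ≤ K) c c'

theorem BddReach.head_sweep {p p' : Q × Phase} {pos h : ℕ} {D : ℕ → Bool} {T : ℕ → ℕ → Cell}
    {w : Cell → Cell} {d : Dir} {o : List B} {c : Cfg (Q × Phase) Cell R × List B}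
    (hh : h ≤ K)
    (hδ : delta R prog p (readInput x pos) (cfg R p pos h D T).scanned =
      some (sweep p' D w d (cfg R p pos h D T).scanned, none))
    (hc : BddReach R K prog q0 x
      ((cfg R p pos h D T).apply x.length (sweep p' D w d (cfg R p pos h D T).scanned), o) c) :
    BddReach R K prog q0 x (cfg R p pos h D T, o) c := by
  refine ReflTransGen.head ⟨?_, ?_⟩ hc
  · exact (congrArg (Option.map _) hδ).trans (congrArg some (Prod.ext rfl (List.append_nil o)))
  · intro i
    simp only [cfg]
    split_ifs <;> omega

theorem BddReach.single_moveInput {p p' : Q × Phase} {pos : ℕ} {D : ℕ → Bool}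
    {T : ℕ → ℕ → Cell} {d : Dir} {o : List B} {b : Option B}
    (hδ : delta R prog p (readInput x pos) (cfg R p pos 0 D T).scanned =
      some (moveInput p' d (cfg R p pos 0 D T).scanned, b)) :
    BddReach R K prog q0 x (cfg R p pos 0 D T, o)
      (cfg R p' (min (d.move pos) (x.length + 1)) 0 D T, o ++ b.toList) := by
  refine ReflTransGen.single ⟨?_, ?_⟩
  · exact (congrArg (Option.map _) hδ).trans (congrArg some (Prod.ext apply_moveInput rfl))
  · intro i
    simp [cfg]

theorem BddReach.sweepBack {pos h i : ℕ} {f : Bool} {D : ℕ → Bool} {T : ℕ → ℕ → Cell}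
    {o : List B} (hpos : pos ≤ x.length + 1) (hi : i < R) (hD : D i = true) (hh : h ≤ K)
    (hδ : ∀ σ, delta R prog (q, .back f) (readInput x pos) σ =
      some (RegMachine.sweepBack q q' f i D σ, none))
    (h0 : marked (T i 0) = true) (h1 : ∀ j, marked (T i (j + 1)) = false) :
    BddReach R K prog q0 x (cfg R (q, .back f) pos h D T, o)
      (cfg R (q', .start) pos 0 D T, o) := by
  induction h with
  | zero =>
    refine BddReach.head_sweep (p' := (q', .start)) (w := id) (d := .stay) hh ?_ ?_
    · rw [hδ, RegMachine.sweepBack, readTape_cfg hi hD, h0, if_pos rfl]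
    · rw [apply_sweep_id hpos]; exact .refl
  | succ h ih =>
    refine BddReach.head_sweep (p' := (q, .back f)) (w := id) (d := .left) hh ?_ ?_
    · rw [hδ, RegMachine.sweepBack, readTape_cfg hi hD, h1]; simp
    · rw [apply_sweep_id hpos]; exact ih (by omega)

/-- While the carry is being propagated, the number on the tape and the pending carry add up to the
final value. -/
theorem BddReach.inc_fwd {pos h i v : ℕ} {T : ℕ → ℕ → Cell} {t : ℕ → Cell} {o : List B} {f : Bool}
    (hq : prog q = .act (.inc i) q') (hi : i < R) (hpos : pos ≤ x.length + 1) (h1 : 1 ≤ h)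
    (hh : h ≤ K) (ht : TapeOk K t) (h0 : marked (t 0) = true) (hp : ∀ j < h, t j ≠ none)
    (hv : tapeVal K t + 2 ^ h = v) (hvK : v < 2 ^ K) :
    ∃ t', TapeOk K t' ∧ tapeVal K t' = v ∧
      BddReach R K prog q0 x (cfg R (q, .fwd f) pos h (· = i) (Function.update T i t), o)
        (cfg R (q', .start) pos 0 (· = i) (Function.update T i t'), o) := by
  have hhK : h < K := by
    by_contra hc
    have : h = K := by omega
    subst this
    omega
  induction hm : K - h generalizing h t f with
  | zero => omega
  | succ m ih =>
    have hr : readTape (cfg R (q, .fwd f) pos h (· = i) (Function.update T i t)).scanned i = t h :=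
      by rw [readTape_cfg hi (by simp)]; simp
    by_cases hb : bit (t h)
    · have e := tapeVal_update hhK t (some (false, false))
      simp only [hb, bit_some, if_true, Bool.false_eq_true, if_false] at e
      have e2 : 2 ^ (h + 1) = 2 * 2 ^ h := by ring
      have hv' : tapeVal K (Function.update t h (some (false, false))) + 2 ^ (h + 1) = v := by omega
      have hhK' : h + 1 < K := by
        by_contra hc
        have : K = h + 1 := by omega
        subst this
        omega
      obtain ⟨t', a, b, c⟩ := ih (f := false) (h := h + 1)
        (t := Function.update t h (some (false, false))) (by omega) (by omega)
        (ht.update_some hhK (by simp) hp) (by rw [Function.update_of_ne (by omega)]; exact h0)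
        (fun j hj => by
          by_cases e : j = h
          · subst e; simp
          · rw [Function.update_of_ne e]; exact hp j (by omega)) hv' hhK' (by omega)
      refine ⟨t', a, b, BddReach.head_sweep (p' := (q, .fwd false))
        (w := fun _ => some (false, false)) (d := .right) hh ?_ ?_⟩
      · simp [delta, hq, hr, hb]
      · rw [apply_sweep_single hpos]
        exact c
    · have e := tapeVal_update hhK t (some (false, true))
      simp only [hb, bit_some, if_true, Bool.false_eq_true, if_false] at e
      refine ⟨Function.update t h (some (false, true)), ht.update_some hhK (by simp) hp,
        by omega, BddReach.head_sweep (p' := (q, .back false))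
        (w := fun _ => some (false, true)) (d := .left) hh ?_ ?_⟩
      · simp [delta, hq, hr, hb]
      · rw [apply_sweep_single hpos]
        have ok := ht.update_some hhK (a := (false, true)) (by simp) hp
        refine BddReach.sweepBack hpos hi (by simp) (by simp only [Dir.move]; omega)
          (fun σ => by simp [delta, hq]) ?_ ?_
        · rw [Function.update_self, Function.update_of_ne (by omega)]; exact h0
        · rw [Function.update_self]; exact ok.mark

/-- Incrementing a register takes one sweep over its tape and back. -/
theorem BddReach.inc {pos i : ℕ} {T : ℕ → ℕ → Cell} {o : List B}
    (hq : prog q = .act (.inc i) q') (hi : i < R) (hpos : pos ≤ x.length + 1)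
    (ht : TapeOk K (T i)) (hK : 1 ≤ K) (hvK : tapeVal K (T i) + 1 < 2 ^ K) :
    ∃ t', TapeOk K t' ∧ tapeVal K t' = tapeVal K (T i) + 1 ∧
      BddReach R K prog q0 x (cfg R (q, .start) pos 0 (· = i) T, o)
        (cfg R (q', .start) pos 0 (· = i) (Function.update T i t'), o) := by
  obtain ⟨t, rfl⟩ : ∃ t, t = T i := ⟨_, rfl⟩
  rw [show cfg R (q, .start) pos 0 (· = i) T =
    cfg R (q, .start) pos 0 (· = i) (Function.update T i (T i)) by simp]
  have hr : readTape (cfg R (q, .start) pos 0 (· = i) (Function.update T i (T i))).scanned i =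
    T i 0 := by rw [readTape_cfg hi (by simp)]; simp
  by_cases hb : bit (T i 0)
  · have e := tapeVal_update (h := 0) hK (T i) (some (true, false))
    simp only [hb, bit_some, if_true, Bool.false_eq_true, if_false] at e
    obtain ⟨t', a, b, c⟩ := BddReach.inc_fwd (v := tapeVal K (T i) + 1) (K := K)
      (t := Function.update (T i) 0 (some (true, false))) (q0 := q0) (o := o) (T := T) (f := false)
      hq hi hpos (le_refl 1) hK (ht.update_some hK (by simp) (by simp)) (by simp)
      (fun j hj => by
        obtain rfl : j = 0 := by omega
        simp) (by rw [pow_zero] at e; omega) hvK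
    refine ⟨t', a, b, BddReach.head_sweep (p' := (q, .fwd false))
        (w := fun _ => some (true, false)) (d := .right) (Nat.zero_le _) ?_ ?_⟩
    · simp only [delta, hq, hr, hb, if_true]
    · rw [apply_sweep_single hpos]
      exact c
  · have e := tapeVal_update (h := 0) hK (T i) (some (true, true))
    simp only [hb, bit_some, if_true, Bool.false_eq_true, if_false] at e
    refine ⟨Function.update (T i) 0 (some (true, true)), ht.update_some hK (by simp) (by simp),
      by simpa using e, BddReach.head_sweep (p' := (q', .start))
        (w := fun _ => some (true, true)) (d := .stay) (Nat.zero_le _) ?_ ?_⟩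
    · simp only [delta, hq, hr, hb, if_false, Bool.false_eq_true]
    · rw [apply_sweep_single hpos]
      exact .refl

/-- The tape of a cleared register. -/
def zeroTape : ℕ → Cell := fun j => if j = 0 then some (true, false) else none

theorem zeroTape_ok (hK : 1 ≤ K) : TapeOk K zeroTape :=
  ⟨fun j => by simp [zeroTape], fun j _ => by simp [zeroTape],
    fun j hj => by simp [zeroTape, show j ≠ 0 by omega]⟩

theorem tapeVal_zeroTape : tapeVal K zeroTape = 0 := by
  refine Finset.sum_eq_zero fun j _ => ?_
  rw [if_neg]
  unfold zeroTape
  split_ifs <;> simp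

theorem BddReach.clr_stop {pos h i : ℕ} {T : ℕ → ℕ → Cell} {t t0 : ℕ → Cell} {o : List B} {f : Bool}
    (hq : prog q = .act (.clr i) q') (hi : i < R) (hpos : pos ≤ x.length + 1) (h1 : 1 ≤ h)
    (hh : h ≤ K) (ht0 : TapeOk K t0) (ht : ∀ j, t j = if j < h then zeroTape j else t0 j)
    (hb : t0 h = none) :
    BddReach R K prog q0 x (cfg R (q, .fwd f) pos h (· = i) (Function.update T i t), o)
        (cfg R (q', .start) pos 0 (· = i) (Function.update T i zeroTape), o) := by
  have hr : readTape
      (cfg R (q, .fwd f) pos h (· = i) (Function.update T i t)).scanned i = t0 h := by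
    rw [readTape_cfg hi (by simp)]; simp [ht]
  have : t = zeroTape := by
    funext j
    rw [ht]
    split_ifs with hj
    · rfl
    · rw [ht0.blank_of_le (not_lt.1 hj) hb, zeroTape, if_neg (by omega)]
  subst this
  refine BddReach.head_sweep (p' := (q, .back false)) (w := id) (d := .left) hh ?_ ?_
  · simp [delta, hq, hr, hb]
  · rw [apply_sweep_id hpos]
    exact BddReach.sweepBack hpos hi (by simp) (by simp only [Dir.move]; omega)
        (fun σ => by simp [delta, hq]) (by simp [zeroTape]) (by simp [zeroTape])

/-- While a register is being cleared, the cells to the left of the head are those of a cleared tape,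
and the other ones are unchanged. -/
theorem BddReach.clr_fwd {pos h i : ℕ} {T : ℕ → ℕ → Cell} {t t0 : ℕ → Cell} {o : List B} {f : Bool}
    (hq : prog q = .act (.clr i) q') (hi : i < R) (hpos : pos ≤ x.length + 1) (h1 : 1 ≤ h)
    (hh : h ≤ K) (ht0 : TapeOk K t0) (ht : ∀ j, t j = if j < h then zeroTape j else t0 j) :
    BddReach R K prog q0 x (cfg R (q, .fwd f) pos h (· = i) (Function.update T i t), o)
        (cfg R (q', .start) pos 0 (· = i) (Function.update T i zeroTape), o) := by
  induction hm : K - h generalizing h t f with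
  | zero => exact clr_stop hq hi hpos h1 hh ht0 ht (ht0.bound h (by omega))
  | succ m ih =>
    by_cases hb : t0 h = none
    · exact clr_stop hq hi hpos h1 hh ht0 ht hb
    · have hr : readTape
          (cfg R (q, .fwd f) pos h (· = i) (Function.update T i t)).scanned i = t0 h := by
        rw [readTape_cfg hi (by simp)]; simp [ht]
      refine BddReach.head_sweep (p' := (q, .fwd false)) (w := fun _ => none) (d := .right) hh ?_ ?_
      · simp [delta, hq, hr, hb]
      · rw [apply_sweep_single hpos]
        refine ih (h := h + 1) (by omega) (by omega) (fun j => ?_) (by omega)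
        by_cases e : j = h
        · subst e
          simp [zeroTape, show j ≠ 0 by omega]
        · rw [Function.update_of_ne e, ht]
          simp only [show j < h + 1 ↔ j < h by omega]

/-- Clearing a register takes one sweep over its tape and back. -/
theorem BddReach.clr {pos i : ℕ} {T : ℕ → ℕ → Cell} {o : List B}
    (hq : prog q = .act (.clr i) q') (hi : i < R) (hpos : pos ≤ x.length + 1)
    (ht : TapeOk K (T i)) (hK : 1 ≤ K) :
      BddReach R K prog q0 x (cfg R (q, .start) pos 0 (· = i) T, o)
        (cfg R (q', .start) pos 0 (· = i) (Function.update T i zeroTape), o) := by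
  rw [show cfg R (q, .start) pos 0 (· = i) T =
    cfg R (q, .start) pos 0 (· = i) (Function.update T i (T i)) by simp]
  refine BddReach.head_sweep (p' := (q, .fwd false))
        (w := fun _ => some (true, false)) (d := .right) (Nat.zero_le _) ?_ ?_
  · simp only [delta, hq]
  · rw [apply_sweep_single hpos]
    refine BddReach.clr_fwd (h := 1) hq hi hpos le_rfl hK ht fun j => ?_
    by_cases e : j = 0
    · subst e; simp [zeroTape]
    · rw [Function.update_of_ne e, if_neg (by omega)]

/-- The flag compares the numbers formed by the digits read so far. The digits are read from the least
significant one on, so a difference in the next digit overrides the flag. -/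
theorem cmpStep_eq (h : ℕ) (t t' : ℕ → Cell) :
    cmpStep (decide (tapeVal h t < tapeVal h t')) (bit (t h)) (bit (t' h)) =
      decide (tapeVal (h + 1) t < tapeVal (h + 1) t') := by
  have a := tapeVal_lt h t
  have b := tapeVal_lt h t'
  rw [tapeVal_succ, tapeVal_succ, cmpStep]
  cases bit (t h) <;> cases bit (t' h) <;> simp <;> omega

theorem BddReach.cmp_stop {pos h i j : ℕ} {T : ℕ → ℕ → Cell} {o : List B} {f : Bool}
    (hq : prog q = .branch (.lt i j) q' q'') (hi : i < R) (hj : j < R) (hpos : pos ≤ x.length + 1)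
    (hh : h ≤ K) (hti : TapeOk K (T i)) (htj : TapeOk K (T j)) (h0 : marked (T i 0) = true)
    (hf : f = decide (tapeVal h (T i) < tapeVal h (T j)))
    (hbi : T i h = none) (hbj : T j h = none) :
    BddReach R K prog q0 x (cfg R (q, .fwd f) pos h (fun l => l = i ∨ l = j) T, o)
      (cfg R (if tapeVal K (T i) < tapeVal K (T j) then q' else q'', .start) pos 0
        (fun l => l = i ∨ l = j) T, o) := by
  refine BddReach.head_sweep (p' := (q, .back f)) (w := id) (d := .left) hh ?_ ?_
  · simp only [delta, hq]
    rw [readTape_cfg hi (by simp), readTape_cfg hj (by simp), if_pos ⟨hbi, hbj⟩]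
  · rw [apply_sweep_id hpos]
    refine BddReach.sweepBack hpos hi (by simp) (by simp only [Dir.move]; omega)
      (fun σ => ?_) h0 hti.mark
    rw [tapeVal_eq_of_blank (fun l hl => hti.blank_of_le hl hbi) hh,
      tapeVal_eq_of_blank (fun l hl => htj.blank_of_le hl hbj) hh, hf]
    simp [delta, hq]

theorem BddReach.cmp_fwd {pos h i j : ℕ} {T : ℕ → ℕ → Cell} {o : List B} {f : Bool}
    (hq : prog q = .branch (.lt i j) q' q'') (hi : i < R) (hj : j < R) (hpos : pos ≤ x.length + 1)
    (hh : h ≤ K) (hti : TapeOk K (T i)) (htj : TapeOk K (T j)) (h0 : marked (T i 0) = true)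
    (hf : f = decide (tapeVal h (T i) < tapeVal h (T j))) :
    BddReach R K prog q0 x (cfg R (q, .fwd f) pos h (fun l => l = i ∨ l = j) T, o)
      (cfg R (if tapeVal K (T i) < tapeVal K (T j) then q' else q'', .start) pos 0
        (fun l => l = i ∨ l = j) T, o) := by
  induction hm : K - h generalizing h f with
  | zero =>
    exact cmp_stop hq hi hj hpos hh hti htj h0 hf
      (hti.bound h (by omega)) (htj.bound h (by omega))
  | succ m ih =>
    by_cases hb : T i h = none ∧ T j h = none
    · exact cmp_stop hq hi hj hpos hh hti htj h0 hf hb.1 hb.2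
    · refine BddReach.head_sweep (p' := (q, .fwd (cmpStep f (bit (T i h)) (bit (T j h)))))
        (w := id) (d := .right) hh ?_ ?_
      · simp only [delta, hq]
        rw [readTape_cfg hi (by simp), readTape_cfg hj (by simp), if_neg hb]
      · rw [apply_sweep_id hpos]
        exact ih (h := h + 1) (by omega) (by rw [hf, cmpStep_eq]) (by omega)

/-- Comparing two registers takes one joint sweep over their tapes. The cells `0` may get marked on the
way, which changes the tapes but not the numbers on them. -/
theorem BddReach.cmp {pos i j : ℕ} {T : ℕ → ℕ → Cell} {o : List B}
    (hq : prog q = .branch (.lt i j) q' q'') (hi : i < R) (hj : j < R) (hpos : pos ≤ x.length + 1)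
    (hK : 1 ≤ K) (ht : ∀ l < R, TapeOk K (T l)) :
    ∃ T', (∀ l < R, TapeOk K (T' l) ∧ tapeVal K (T' l) = tapeVal K (T l)) ∧
      BddReach R K prog q0 x (cfg R (q, .start) pos 0 (fun l => l = i ∨ l = j) T, o)
      (cfg R (if tapeVal K (T i) < tapeVal K (T j) then q' else q'', .start) pos 0
        (fun l => l = i ∨ l = j) T', o) := by
  have bits : ∀ (t : ℕ → Cell) l, bit (Function.update t 0 (mark (t 0)) l) = bit (t l) := by
    intro t l
    by_cases e : l = 0
    · subst e; simp
    · rw [Function.update_of_ne e]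
  set T' : ℕ → ℕ → Cell := fun l => if decide (l = i ∨ l = j) = true then
    Function.update (T l) 0 (mark (T l 0)) else T l with hT'
  have hok : ∀ l < R, TapeOk K (T' l) ∧ ∀ h, tapeVal h (T' l) = tapeVal h (T l) := by
    intro l hl
    simp only [hT']
    split_ifs
    · exact ⟨(ht l hl).update_some hK (by simp) (by simp), fun h => tapeVal_congr (bits _)⟩
    · exact ⟨ht l hl, fun h => rfl⟩
  refine ⟨T', fun l hl => ⟨(hok l hl).1, (hok l hl).2 K⟩, ?_⟩
  refine BddReach.head_sweep (p' := (q, .fwd (cmpStep false (bit (T i 0)) (bit (T j 0)))))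
    (w := mark) (d := .right) (Nat.zero_le _) ?_ ?_
  · simp only [delta, hq]
    rw [readTape_cfg hi (by simp), readTape_cfg hj (by simp)]
  · rw [apply_sweep hpos, ← (hok i hi).2 K, ← (hok j hj).2 K]
    refine BddReach.cmp_fwd hq hi hj hpos hK (hok i hi).1 (hok j hj).1 ?_ ?_
    · simp
    · have := cmpStep_eq 0 (T i) (T j)
      simp only [tapeVal, Finset.range_zero, Finset.sum_empty, lt_irrefl, decide_false] at this
      rw [this, show Dir.right.move 0 = 0 + 1 from rfl, (hok i hi).2, (hok j hj).2]
      rfl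

theorem readInput_succ_ne (x : List A) (p : ℕ) : readInput x (p + 1) ≠ .leftEnd := by
  simp only [readInput]
  split <;> simp

theorem readInput_of_length_lt {x : List A} {p : ℕ} (h : x.length < p) :
    readInput x p = .rightEnd := by
  obtain ⟨p, rfl⟩ := Nat.exists_eq_succ_of_ne_zero (by omega : p ≠ 0)
  simp [readInput, List.getElem?_eq_none (show x.length ≤ p by omega)]

theorem readInput_eq_rightEnd_iff {x : List A} {p : ℕ} :
    readInput x p = .rightEnd ↔ x.length < p := by
  refine ⟨fun h => ?_, readInput_of_length_lt⟩
  cases p with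
  | zero => simp [readInput] at h
  | succ p =>
    by_contra hc
    have hp : p < x.length := by omega
    simp [readInput, List.getElem?_eq_getElem hp] at h

theorem BddReach.home {pos : ℕ} {D : ℕ → Bool} {T : ℕ → ℕ → Cell} {o : List B}
    (hq : prog q = .act .home q') (hpos : pos ≤ x.length + 1) :
    BddReach R K prog q0 x (cfg R (q, .start) pos 0 D T, o)
      (cfg R (q', .start) 0 0 D T, o) := by
  induction pos with
  | zero =>
    have := BddReach.single_moveInput (R := R) (K := K) (prog := prog) (q0 := q0) (x := x) (pos := 0) (D := D)
      (T := T) (p := (q, .start)) (p' := (q', .start)) (d := .stay) (o := o) (b := none)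
      (by simp [delta, hq, readInput])
    simpa [Dir.move] using this
  | succ pos ih =>
    have := BddReach.single_moveInput (R := R) (K := K) (prog := prog) (q0 := q0) (x := x) (pos := pos + 1)
      (D := D) (T := T) (p := (q, .start)) (p' := (q, .start)) (d := .left) (o := o) (b := none)
      (by
        have := readInput_succ_ne x pos
        cases h : readInput x (pos + 1) <;> simp_all [delta])
    rw [show min (Dir.left.move (pos + 1)) (x.length + 1) = pos by simp only [Dir.move]; omega,
      Option.toList_none, List.append_nil] at this
    exact ReflTransGen.trans this (ih (by omega))

/-- The tapes `T` hold the registers of `s`. -/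
structure Represents (R K n : ℕ) (T : ℕ → ℕ → Cell) (s : State B) : Prop where
  ok : ∀ l < R, TapeOk K (T l)
  val : ∀ l < R, tapeVal K (T l) = s.reg l
  pos : s.pos ≤ n + 1

/-- The transducer simulates each step of the register machine. -/
theorem exists_bddReach_of_step (hR : ∀ q, (prog q).RegsLT R) (hK : 1 ≤ K) {G : ℕ}
    (hG : G < 2 ^ K) {c c' : Q × State B} (h : Step prog x G c c') {T : ℕ → ℕ → Cell}
    (hT : Represents R K x.length T c.2) :
    ∃ T', Represents R K x.length T' c'.2 ∧ ∀ D, BddReach R K prog q0 x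
      (cfg R (c.1, .start) c.2.pos 0 D T, c.2.output)
      (cfg R (c'.1, .start) c'.2.pos 0 D T', c'.2.output) := by
  obtain ⟨q, s⟩ := c
  obtain ⟨q', s'⟩ := c'
  have hr := hR q
  simp only [Step] at h
  simp only at hT ⊢
  have hpos := hT.pos
  have upd : ∀ {i v : ℕ} {t : ℕ → Cell} {s' : State B}, TapeOk K t → tapeVal K t = v →
      s'.reg = Function.update s.reg i v → s'.pos = s.pos →
      Represents R K x.length (Function.update T i t) s' := by
    intro i v t s' h1 h2 h3 h4
    refine ⟨fun l hl => ?_, fun l hl => ?_, h4 ▸ hpos⟩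
    · by_cases e : l = i
      · subst e; simpa using h1
      · rw [Function.update_of_ne e]; exact hT.ok l hl
    · by_cases e : l = i
      · subst e; simpa [h3] using h2
      · rw [h3, Function.update_of_ne e, Function.update_of_ne e]; exact hT.val l hl
  rcases hq : prog q with ⟨a, p⟩ | ⟨a, p, p'⟩ | _
  · rw [hq] at h hr
    simp only [Instr.exec] at h
    cases a with
    | inc i =>
      simp only [Act.run] at h
      split_ifs at h with hlt
      · simp only [Option.map_some, Option.some.injEq, Prod.mk.injEq] at h
        obtain ⟨rfl, rfl⟩ := h
        obtain ⟨t', h1, h2, h3⟩ := BddReach.inc (q0 := q0) (x := x) (T := T) (K := K)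
          (o := s.output) hq hr hpos (hT.ok i hr) hK (by rw [hT.val i hr]; omega)
        rw [hT.val i hr] at h2
        exact ⟨_, upd h1 h2 rfl rfl, fun D => by
          rw [cfg_zero _ _ _ D (· = i), cfg_zero _ _ _ D (· = i)]; exact h3⟩
      · simp at h
    | clr i =>
      simp only [Act.run, Option.map_some, Option.some.injEq, Prod.mk.injEq] at h
      obtain ⟨rfl, rfl⟩ := h
      exact ⟨_, upd (zeroTape_ok hK) tapeVal_zeroTape rfl rfl, fun D => by
          rw [cfg_zero _ _ _ D (· = i), cfg_zero _ _ _ D (· = i)]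
          exact BddReach.clr hq hr hpos (hT.ok i hr) hK⟩
    | home =>
      simp only [Act.run, Option.map_some, Option.some.injEq, Prod.mk.injEq] at h
      obtain ⟨rfl, rfl⟩ := h
      exact ⟨T, ⟨hT.ok, hT.val, by simp⟩, fun D => BddReach.home hq hpos⟩
    | right =>
      simp only [Act.run, Option.map_some, Option.some.injEq, Prod.mk.injEq] at h
      obtain ⟨rfl, rfl⟩ := h
      refine ⟨T, ⟨hT.ok, hT.val, by simp⟩, fun D => ?_⟩
      have := BddReach.single_moveInput (R := R) (K := K) (prog := prog) (q0 := q0) (x := x) (pos := s.pos)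
        (D := D) (T := T) (p := (q, .start)) (p' := (p, .start)) (d := .right) (o := s.output)
        (b := none) (by simp [delta, hq])
      simpa [Dir.move] using this
    | out b =>
      simp only [Act.run, Option.map_some, Option.some.injEq, Prod.mk.injEq] at h
      obtain ⟨rfl, rfl⟩ := h
      refine ⟨T, ⟨hT.ok, hT.val, hpos⟩, fun D => ?_⟩
      have := BddReach.single_moveInput (R := R) (K := K) (prog := prog) (q0 := q0) (x := x) (pos := s.pos)
        (D := D) (T := T) (p := (q, .start)) (p' := (p, .start)) (d := .stay) (o := s.output)
        (b := some b) (by simp [delta, hq])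
      simpa [Dir.move, hpos] using this
  · rw [hq] at h hr
    simp only [Instr.exec, Option.some.injEq, Prod.mk.injEq] at h
    obtain ⟨rfl, rfl⟩ := h
    cases a with
    | lt i j =>
      obtain ⟨T', h1, h2⟩ := BddReach.cmp (q0 := q0) (x := x) (T := T) (K := K)
          (o := s.output) hq hr.1 hr.2 hpos hK hT.ok
      refine ⟨T', ⟨fun l hl => (h1 l hl).1, fun l hl => (h1 l hl).2.trans (hT.val l hl), hpos⟩,
        fun D => ?_⟩
      rw [cfg_zero _ _ _ D (fun l => l = i ∨ l = j), cfg_zero _ _ _ D (fun l => l = i ∨ l = j)]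
      rw [hT.val i hr.1, hT.val j hr.2] at h2
      simpa [Cond.eval] using h2
    | inp P =>
      refine ⟨T, hT, fun D => ?_⟩
      have := BddReach.single_moveInput (R := R) (K := K) (prog := prog) (q0 := q0) (x := x) (pos := s.pos)
        (D := D) (T := T) (p := (q, .start))
        (p' := (if P (readInput x s.pos) then p else p', .start)) (d := .stay) (o := s.output)
        (b := none) (by simp [delta, hq])
      simp only [Dir.move, hpos, min_eq_left, Option.toList_none, List.append_nil] at this
      exact this
  · rw [hq] at h
    simp [Instr.exec] at h

theorem exists_bddReach (hR : ∀ q, (prog q).RegsLT R) (hK : 1 ≤ K) {G : ℕ}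
    (hG : G < 2 ^ K) {c c' : Q × State B} (h : ReflTransGen (Step prog x G) c c')
    {T : ℕ → ℕ → Cell} (hT : Represents R K x.length T c.2) :
    ∃ T', Represents R K x.length T' c'.2 ∧ ∀ D, BddReach R K prog q0 x
      (cfg R (c.1, .start) c.2.pos 0 D T, c.2.output)
      (cfg R (c'.1, .start) c'.2.pos 0 D T', c'.2.output) := by
  induction h with
  | refl => exact ⟨T, hT, fun D => .refl⟩
  | tail _ h ih =>
    obtain ⟨T1, h1, h2⟩ := ih
    obtain ⟨T2, h3, h4⟩ := exists_bddReach_of_step (q0 := q0) hR hK hG h h1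
    exact ⟨T2, h3, fun D => ReflTransGen.trans (h2 D) (h4 D)⟩

/-- If a deterministic run ends in a halting configuration, every reachable configuration lies
on it. -/
theorem of_reflTransGen_of_halting {α : Type} {f : α → Option α} {P : α → Prop} {a b c : α}
    (h : ReflTransGen (fun e e' => f e = some e' ∧ P e) a b) (hb : f b = none) (hPb : P b)
    (hc : ReflTransGen (fun e e' => f e = some e') a c) : P c := by
  induction h using ReflTransGen.head_induction_on with
  | refl =>
    rcases hc.cases_head with rfl | ⟨d, hd, -⟩
    · exact hPb
    · rw [hb] at hd; cases hd
  | head h1 _ ih =>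
    rcases hc.cases_head with rfl | ⟨d, hd, h2⟩
    · exact h1.2
    · rw [h1.1] at hd
      cases hd
      exact ih h2

/-- A function is computable in logarithmic space if a register machine computes it with register
contents that are polynomial in the length of the input. -/
theorem logspaceComputable_of_program (prog : Q → Instr A B Q) (q0 : Q) (g : List A → List B)
    (c : ℕ) (h : ∀ x : List A, ∃ q s, ReflTransGen (Step prog x ((x.length + 2) ^ c))
      (q0, ⟨fun _ => 0, 0, []⟩) (q, s) ∧ prog q = .halt ∧ s.output = g x) :
    LogspaceComputable g := by
  obtain ⟨R, hR⟩ := exists_regsLT prog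
  have key : ∀ x : List A, ∃ e, BddReach R ((2 * c + 1) * Nat.log 2 x.length + (2 * c + 1)) prog q0 x
      (transducer R prog q0).init e ∧ (transducer R prog q0).step x e = none ∧ e.2 = g x ∧
      ∀ i, e.1.head i ≤ (2 * c + 1) * Nat.log 2 x.length + (2 * c + 1) := by
    intro x
    obtain ⟨q, s, h1, h2, h3⟩ := h x
    set K := (2 * c + 1) * Nat.log 2 x.length + (2 * c + 1) with hK
    have hG : (x.length + 2) ^ c < 2 ^ K := by
      have : x.length + 2 ≤ 2 ^ (Nat.log 2 x.length + 2) := by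
        have h1 := Nat.lt_pow_succ_log_self (b := 2) (by norm_num) x.length
        have h2 : 1 ≤ 2 ^ (Nat.log 2 x.length + 1) := Nat.one_le_two_pow
        rw [pow_succ _ (Nat.log 2 x.length + 1)]
        simp only [Nat.succ_eq_add_one] at h1
        omega
      calc (x.length + 2) ^ c ≤ (2 ^ (Nat.log 2 x.length + 2)) ^ c := Nat.pow_le_pow_left this c
        _ = 2 ^ ((Nat.log 2 x.length + 2) * c) := (pow_mul _ _ _).symm
        _ < 2 ^ K := Nat.pow_lt_pow_right (by norm_num) (by rw [hK]; nlinarith)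
    obtain ⟨T, -, hT⟩ := exists_bddReach (q0 := q0) (K := K) (T := fun _ _ => none) hR (by omega)
      hG h1 ⟨fun l _ => ⟨by simp, by simp, by simp⟩, fun l _ => by simp [tapeVal], by simp⟩
    refine ⟨(cfg R (q, .start) s.pos 0 (fun _ => false) T, s.output), ?_, ?_, h3, ?_⟩
    · have := hT fun _ => false
      simpa [cfg, Transducer.init, transducer] using this
    · have : ∀ a σ, delta R prog (q, .start) a σ = none := fun a σ => by simp [delta, h2]
      exact congrArg (Option.map _) (this _ _)
    · intro i
      simp [cfg]
  refine ⟨transducer R prog q0, ⟨2 * c + 1, fun x e he => ?_⟩, fun x => ?_⟩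
  · obtain ⟨e', h1, h2, -, h4⟩ := key x
    exact of_reflTransGen_of_halting (P := fun e : Cfg (Q × Phase) Cell R × List B =>
      ∀ i, e.1.head i ≤ (2 * c + 1) * Nat.log 2 x.length + (2 * c + 1)) h1 h2 h4 he
  · obtain ⟨e', h1, h2, h3, -⟩ := key x
    exact ⟨e', ReflTransGen.mono (fun _ _ h => h.1) _ _ h1, h2, h3⟩

end Simulation

end RegMachine

/-! ### Structured programs -/

namespace RegMachine

open Relation

variable {A B Q Q' Q'' : Type}

/-- Renaming the jump targets of an instruction. -/
def Instr.map (e : Q → Q') : Instr A B Q → Instr A B Q'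
  | act a q => act a (e q)
  | branch c q q' => branch c (e q) (e q')
  | halt => halt

theorem Instr.map_map (e : Q → Q') (e' : Q' → Q'') (I : Instr A B Q) :
    (I.map e).map e' = I.map (e' ∘ e) := by cases I <;> rfl

/-- A program fragment with one entry and one exit; the jump target `none` is the exit. -/
structure Frag (A B : Type) where
  X : Type
  fin : Finite X
  code : X → Instr A B (Option X)
  entry : Option X

/-- In every program that contains the fragment `F`, executing `F` leads from the data `s` to the
data `s'`. -/
def Frag.Runs (F : Frag A B) (x : List A) (G : ℕ) (s s' : State B) : Prop :=
  ∀ (Q : Type) (prog : Q → Instr A B Q) (e : Option F.X → Q),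
    (∀ y, prog (e (some y)) = (F.code y).map e) →
      ReflTransGen (Step prog x G) (e F.entry, s) (e none, s')

namespace Frag

/-- A single instruction. -/
def act (a : Act B) : Frag A B := ⟨Unit, inferInstance, fun _ => .act a none, some ()⟩

/-- The empty fragment. -/
def skip : Frag A B := ⟨Empty, inferInstance, fun y => y.elim, none⟩

/-- Sequential composition. -/
def seq (F F' : Frag A B) : Frag A B where
  X := F.X ⊕ F'.X
  fin := by have := F.fin; have := F'.fin; infer_instance
  code := Sum.elim
    (fun y => (F.code y).map fun o => o.elim (F'.entry.map Sum.inr) fun z => some (Sum.inl z))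
    (fun y => (F'.code y).map (Option.map Sum.inr))
  entry := F.entry.elim (F'.entry.map Sum.inr) fun z => some (Sum.inl z)

/-- Branching. -/
def ite (c : Cond A) (F F' : Frag A B) : Frag A B where
  X := Option (F.X ⊕ F'.X)
  fin := by have := F.fin; have := F'.fin; infer_instance
  code := fun o => o.elim
    (.branch c (F.entry.map fun y => some (Sum.inl y)) (F'.entry.map fun y => some (Sum.inr y)))
    (Sum.elim (fun y => (F.code y).map (Option.map fun y => some (Sum.inl y)))
      (fun y => (F'.code y).map (Option.map fun y => some (Sum.inr y))))
  entry := some none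

/-- Iteration as long as the test succeeds. -/
def loop (c : Cond A) (F : Frag A B) : Frag A B where
  X := Option F.X
  fin := by have := F.fin; infer_instance
  code := fun o => o.elim
    (.branch c (F.entry.elim (some none) fun y => some (some y)) none)
    (fun y => (F.code y).map fun o => o.elim (some none) fun y => some (some y))
  entry := some none

variable {F F' : Frag A B} {x : List A} {G : ℕ} {s s' s'' : State B}

theorem runs_act {a : Act B} (h : a.run x.length G s = some s') : (act a).Runs x G s s' := by
  intro Q prog e he
  refine ReflTransGen.single ?_
  have : prog (e (some ())) = .act a (e none) := he ()
  change (prog (e (some ()))).exec x G s = _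
  rw [this, Instr.exec, h, Option.map_some]

theorem runs_skip : (skip : Frag A B).Runs x G s s := fun _ _ _ _ => .refl

theorem Runs.seq (h : F.Runs x G s s') (h' : F'.Runs x G s' s'') :
    (F.seq F').Runs x G s s'' := by
  intro Q prog e he
  have h1 := h Q prog
    (fun o => e (o.elim (F'.entry.map Sum.inr) fun z => some (Sum.inl z)))
    (fun y => (he (Sum.inl y)).trans (Instr.map_map _ _ _))
  have h2 := h' Q prog (fun o => e (o.map Sum.inr))
    (fun y => (he (Sum.inr y)).trans (Instr.map_map _ _ _))
  exact h1.trans h2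

theorem Runs.ite {c : Cond A} (h : if c.eval x s then F.Runs x G s s' else F'.Runs x G s s') :
    (Frag.ite c F F').Runs x G s s' := by
  intro Q prog e he
  have h0 := he none
  refine ReflTransGen.head (b := (if c.eval x s then
    e (F.entry.map fun y => some (Sum.inl y)) else e (F'.entry.map fun y => some (Sum.inr y)), s)) ?_ ?_
  · simp only [Step, Frag.ite] at h0 ⊢
    rw [h0]
    rfl
  · split_ifs at h ⊢
    · exact h Q prog (fun o => e (o.map fun y => some (Sum.inl y)))
        (fun y => (he (some (Sum.inl y))).trans (Instr.map_map _ _ _))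
    · exact h Q prog (fun o => e (o.map fun y => some (Sum.inr y)))
        (fun y => (he (some (Sum.inr y))).trans (Instr.map_map _ _ _))

theorem runs_loop_of_false {c : Cond A} (h : c.eval x s = false) :
    (Frag.loop c F).Runs x G s s := by
  intro Q prog e he
  have h0 := he none
  refine ReflTransGen.single ?_
  simp only [Step, Frag.loop] at h0 ⊢
  rw [h0]
  simp [Instr.map, Instr.exec, h]

theorem runs_loop_of_true {c : Cond A} (h : c.eval x s = true) (h1 : F.Runs x G s s')
    (h2 : (Frag.loop c F).Runs x G s' s'') : (Frag.loop c F).Runs x G s s'' := by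
  intro Q prog e he
  have h0 := he none
  refine ReflTransGen.head (b := (e (F.entry.elim (some none) fun y => some (some y)), s)) ?_ ?_
  · simp only [Step, Frag.loop] at h0 ⊢
    rw [h0]
    simp [Instr.map, Instr.exec, h]
  · have h1' := h1 Q prog (fun o => e (o.elim (some none) fun y => some (some y)))
      (fun y => (he (some y)).trans (Instr.map_map _ _ _))
    exact h1'.trans (h2 Q prog e he)

/-- A loop whose body is executed exactly `n` times; `I k` holds after `k` rounds. -/
theorem exists_runs_loop {c : Cond A} (n : ℕ) (I : ℕ → State B → Prop)
    (hI : ∀ k < n, ∀ s, I k s → c.eval x s = true ∧ ∃ s', F.Runs x G s s' ∧ I (k + 1) s')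
    (hn : ∀ s, I n s → c.eval x s = false) (h0 : I 0 s) :
    ∃ s', (Frag.loop c F).Runs x G s s' ∧ I n s' := by
  suffices H : ∀ m k s, n - k = m → k ≤ n → I k s → ∃ s', (Frag.loop c F).Runs x G s s' ∧ I n s' from
    H n 0 s rfl (Nat.zero_le _) h0
  intro m
  induction m with
  | zero =>
    intro k s hk hkn h
    obtain rfl : k = n := by omega
    exact ⟨s, runs_loop_of_false (hn s h), h⟩
  | succ m ih =>
    intro k s hk hkn h
    obtain ⟨h1, s', h2, h3⟩ := hI k (by omega) s h
    obtain ⟨s'', h4, h5⟩ := ih (k + 1) s' (by omega) (by omega) h3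
    exact ⟨s'', runs_loop_of_true h1 h2 h4, h5⟩

theorem runs_inc {i : ℕ} (h : s.reg i < G) : (act (.inc i) : Frag A B).Runs x G s
    ⟨Function.update s.reg i (s.reg i + 1), s.pos, s.output⟩ :=
  runs_act (by simp [Act.run, h])

theorem runs_clr {i : ℕ} : (act (.clr i) : Frag A B).Runs x G s
    ⟨Function.update s.reg i 0, s.pos, s.output⟩ :=
  runs_act rfl

theorem runs_home : (act .home : Frag A B).Runs x G s ⟨s.reg, 0, s.output⟩ := runs_act rfl

theorem runs_right : (act .right : Frag A B).Runs x G s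
    ⟨s.reg, min (s.pos + 1) (x.length + 1), s.output⟩ := runs_act rfl

/-- Adding the register `j` to the register `i`, with `k` as an auxiliary register. -/
def add (i j k : ℕ) : Frag A B :=
  (act (.clr k)).seq (loop (.lt k j) ((act (.inc i)).seq (act (.inc k))))

theorem exists_runs_add {i j k : ℕ} (hij : i ≠ j) (hik : i ≠ k) (hjk : j ≠ k)
    (hG : s.reg i + s.reg j ≤ G) :
    ∃ s', (add i j k).Runs x G s s' ∧ s'.reg i = s.reg i + s.reg j ∧
      (∀ l, l ≠ i → l ≠ k → s'.reg l = s.reg l) ∧ s'.output = s.output := by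
  obtain ⟨s', h1, h2, -, h3, h4⟩ := exists_runs_loop (c := .lt k j) (x := x) (G := G)
    (F := (act (.inc i) : Frag A B).seq (act (.inc k)))
    (s := ⟨Function.update s.reg k 0, s.pos, s.output⟩) (s.reg j)
    (fun n s' => s'.reg i = s.reg i + n ∧ s'.reg k = n ∧
      (∀ l, l ≠ i → l ≠ k → s'.reg l = s.reg l) ∧ s'.output = s.output)
    (fun n hn s' ⟨a1, a2, a3, a4⟩ => ⟨by simp [Cond.eval, a2, a3 j hij.symm hjk, hn],
      _, (runs_inc (by omega)).seq (runs_inc (by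
        dsimp only; rw [Function.update_of_ne hik.symm]; omega)), by
        refine ⟨?_, ?_, ?_, a4⟩
        · simp [hik, a1]; omega
        · simp [hik.symm, a2]
        · intro l h1 h2; simp [h1, h2, a3 l h1 h2]⟩)
    (fun s' ⟨a1, a2, a3, a4⟩ => by simp [Cond.eval, a2, a3 j hij.symm hjk])
    ⟨by simp [hik], by simp, fun l h1 h2 => by simp [h2], rfl⟩
  exact ⟨s', runs_clr.seq h1, h2, h3, h4⟩

end Frag

/-! ### Functions computed by structured programs -/

/-- The function `f` of the input and of an environment of numbers is computed by a structured
program with polynomially bounded registers. The variable `i` of the environment is held in the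
register `p i`; the program leaves the result in the register `b`, keeps all registers below `b` and
may change those above. The exponent `c` bounds the result as well as the registers needed. -/
def RegComputable (B : Type) (f : List A → (ℕ → ℕ) → ℕ) : Prop :=
  ∃ c : ℕ, (∀ x v M, x.length ≤ M → (∀ i, v i ≤ M) → f x v ≤ (M + 2) ^ c) ∧
    ∀ (p : ℕ → ℕ) (b : ℕ), (∀ i, p i < b) → ∃ F : Frag A B, ∀ x M G s,
      x.length ≤ M → (∀ i, s.reg (p i) ≤ M) → (M + 2) ^ c ≤ G →
      ∃ s', F.Runs x G s s' ∧ s'.reg b = f x (s.reg ∘ p) ∧ (∀ i < b, s'.reg i = s.reg i) ∧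
        s'.output = s.output

/-- The environment in which a new variable `0` has the value `i`; the other variables are
shifted. -/
def push (i : ℕ) (v : ℕ → ℕ) : ℕ → ℕ
  | 0 => i
  | n + 1 => v n

@[simp] theorem push_zero (i : ℕ) (v : ℕ → ℕ) : push i v 0 = i := rfl
@[simp] theorem push_succ (i : ℕ) (v : ℕ → ℕ) (n : ℕ) : push i v (n + 1) = v n := rfl

theorem pow_le_of_le {M a b G : ℕ} (h : (M + 2) ^ b ≤ G) (hab : a ≤ b) : (M + 2) ^ a ≤ G :=
  (Nat.pow_le_pow_right (by omega) hab).trans h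

theorem add_pow_le (M c : ℕ) : M + 2 + (M + 2) ^ c ≤ (M + 2) ^ (c + 2) := by
  have h : 1 ≤ (M + 2) ^ c := Nat.one_le_pow _ _ (by omega)
  have h1 := Nat.le_mul_of_pos_left (M + 2) h
  have h2 := Nat.le_mul_of_pos_right ((M + 2) ^ c) (show 0 < M + 2 by omega)
  have h3 := Nat.mul_le_mul_left ((M + 2) ^ c * (M + 2)) (show 2 ≤ M + 2 by omega)
  rw [pow_add, pow_two, ← mul_assoc]
  omega

theorem pow_two_mul_le (M c : ℕ) : 2 * (M + 2) ^ c ≤ (M + 2) ^ (c + 1) := by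
  rw [pow_succ]
  nlinarith [Nat.zero_le ((M + 2) ^ c)]

namespace RegComputable

variable {f g h k : List A → (ℕ → ℕ) → ℕ}

theorem congr (hf : RegComputable B f) (e : ∀ x v, g x v = f x v) : RegComputable B g := by
  obtain rfl : g = f := funext fun x => funext fun v => e x v
  exact hf

/-- Renaming the variables. -/
theorem rename (hf : RegComputable B f) (ρ : ℕ → ℕ) :
    RegComputable B fun x v => f x (fun i => v (ρ i)) := by
  obtain ⟨c, h1, h2⟩ := hf
  refine ⟨c, fun x v M hx hv => h1 x _ M hx fun i => hv _, fun p b hp => ?_⟩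
  obtain ⟨F, hF⟩ := h2 (fun i => p (ρ i)) b fun i => hp _
  exact ⟨F, fun x M G s hx hs hG => hF x M G s hx (fun i => hs _) hG⟩

/-- Ignoring the most recent variable. -/
theorem shift (hf : RegComputable B f) : RegComputable B fun x v => f x (fun i => v (i + 1)) :=
  hf.rename (· + 1)

theorem var (i : ℕ) : RegComputable B fun (_ : List A) v => v i := by
  refine ⟨1, fun x v M _ hv => ?_, fun p b hp => ?_⟩
  · have := hv i; simp; omega
  · refine ⟨(Frag.act (.clr b)).seq (Frag.add b (p i) (b + 1)), fun x M G s _ hs hG => ?_⟩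
    have hi := hp i
    obtain ⟨s', h1, h2, h3, h4⟩ := Frag.exists_runs_add (A := A) (x := x) (G := G) (i := b) (j := p i)
      (k := b + 1) (s := ⟨Function.update s.reg b 0, s.pos, s.output⟩) (by omega) (by omega)
      (by omega) (by
        have := hs i
        simp only [Function.update_self, Function.update_of_ne hi.ne]
        rw [pow_one] at hG
        omega)
    refine ⟨s', Frag.runs_clr.seq h1, ?_, fun l hl => ?_, h4⟩
    · simp [h2, Function.update_of_ne hi.ne]
    · rw [h3 l (by omega) (by omega)]
      exact Function.update_of_ne hl.ne _ _

theorem const (n : ℕ) : RegComputable B fun (_ : List A) _ => n := by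
  induction n with
  | zero =>
    exact ⟨0, by simp, fun p b hp => ⟨Frag.act (.clr b), fun x M G s _ _ _ =>
      ⟨_, Frag.runs_clr, by simp, fun i hi => by simp [hi.ne], rfl⟩⟩⟩
  | succ n ih =>
    obtain ⟨c, h1, h2⟩ := ih
    have key : ∀ M, n + 1 ≤ (M + 2) ^ (c + 1) := fun M => by
      have a : n ≤ (M + 2) ^ c := h1 [] (fun _ => 0) M (by simp) (by simp)
      have b := pow_two_mul_le M c
      have d : 1 ≤ (M + 2) ^ c := Nat.one_le_pow _ _ (by omega)
      omega
    refine ⟨c + 1, fun x v M _ _ => key M, fun p b hp => ?_⟩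
    obtain ⟨F, hF⟩ := h2 p b hp
    refine ⟨F.seq (Frag.act (.inc b)), fun x M G s hx hs hG => ?_⟩
    obtain ⟨s', a1, a2, a3, a4⟩ := hF x M G s hx hs (pow_le_of_le hG (by omega))
    have := (key M).trans hG
    replace a2 : s'.reg b = n := a2
    exact ⟨_, a1.seq (Frag.runs_inc (by omega)), by simp [a2],
      fun i hi => by simp [hi.ne, a3 i hi], a4⟩

/-- Case distinction by comparing two numbers. -/
theorem ite_lt (hf : RegComputable B f) (hg : RegComputable B g) (hh : RegComputable B h)
    (hk : RegComputable B k) :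
    RegComputable B fun x v => if f x v < g x v then h x v else k x v := by
  obtain ⟨c1, b1, h1⟩ := hf
  obtain ⟨c2, b2, h2⟩ := hg
  obtain ⟨c3, b3, h3⟩ := hh
  obtain ⟨c4, b4, h4⟩ := hk
  refine ⟨c1 + c2 + c3 + c4, fun x v M hx hv => ?_, fun p b hp => ?_⟩
  · have e3 := pow_le_of_le (le_refl ((M + 2) ^ (c1 + c2 + c3 + c4))) (a := c3) (by omega)
    have e4 := pow_le_of_le (le_refl ((M + 2) ^ (c1 + c2 + c3 + c4))) (a := c4) (by omega)
    beta_reduce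
    split_ifs
    · exact (b3 x v M hx hv).trans e3
    · exact (b4 x v M hx hv).trans e4
  · obtain ⟨F1, H1⟩ := h1 p b hp
    obtain ⟨F2, H2⟩ := h2 p (b + 1) fun i => (hp i).trans (Nat.lt_succ_self b)
    obtain ⟨F3, H3⟩ := h3 p b hp
    obtain ⟨F4, H4⟩ := h4 p b hp
    refine ⟨(F1.seq F2).seq (Frag.ite (.lt b (b + 1)) F3 F4), fun x M G s hx hs hG => ?_⟩
    obtain ⟨s1, r1, e1, k1, o1⟩ := H1 x M G s hx hs (pow_le_of_le hG (by omega))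
    have p1 : s1.reg ∘ p = s.reg ∘ p := funext fun i => k1 _ (hp i)
    obtain ⟨s2, r2, e2, k2, o2⟩ := H2 x M G s1 hx (fun i => by rw [k1 _ (hp i)]; exact hs i)
      (pow_le_of_le hG (by omega))
    have k2' : ∀ i < b, s2.reg i = s.reg i := fun i hi => (k2 i (by omega)).trans (k1 i hi)
    have p2 : s2.reg ∘ p = s.reg ∘ p := funext fun i => k2' _ (hp i)
    have hs2 : ∀ i, s2.reg (p i) ≤ M := fun i => by rw [k2' _ (hp i)]; exact hs i
    have hc : (Cond.lt b (b + 1) : Cond A).eval x s2 =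
        decide (f x (s.reg ∘ p) < g x (s.reg ∘ p)) := by
      simp only [Cond.eval, e2, k2 b (by omega), e1, p1]
    by_cases hlt : f x (s.reg ∘ p) < g x (s.reg ∘ p)
    · obtain ⟨s3, r3, e3, k3, o3⟩ := H3 x M G s2 hx hs2 (pow_le_of_le hG (by omega))
      exact ⟨s3, (r1.seq r2).seq (Frag.Runs.ite (by simpa [hc, hlt] using r3)),
        by rw [e3, p2]; exact (if_pos hlt).symm, fun i hi => (k3 i hi).trans (k2' i hi), by rw [o3, o2, o1]⟩
    · obtain ⟨s3, r3, e3, k3, o3⟩ := H4 x M G s2 hx hs2 (pow_le_of_le hG (by omega))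
      exact ⟨s3, (r1.seq r2).seq (Frag.Runs.ite (by simpa [hc, hlt] using r3)),
        by rw [e3, p2]; exact (if_neg hlt).symm, fun i hi => (k3 i hi).trans (k2' i hi), by rw [o3, o2, o1]⟩

/-- Bounded summation; the summation variable is the most recent variable of the summand. -/
theorem sum (hf : RegComputable B f) (hg : RegComputable B g) :
    RegComputable B fun x v => ∑ i ∈ Finset.range (f x v), g x (push i v) := by
  obtain ⟨c1, b1, h1⟩ := hf
  obtain ⟨c2, b2, h2⟩ := hg
  have bd : ∀ x v M, x.length ≤ M → (∀ i, v i ≤ M) → ∀ i < f x v,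
      g x (push i v) ≤ (M + 2) ^ ((c1 + 2) * c2) := by
    intro x v M hx hv i hi
    have hf := b1 x v M hx hv
    have h := add_pow_le M c1
    refine (b2 x (push i v) (M + (M + 2) ^ c1) (by omega) fun j => ?_).trans ?_
    · cases j with
      | zero => simp; omega
      | succ j => have := hv j; simp; omega
    · rw [pow_mul]
      exact Nat.pow_le_pow_left (by omega) _
  have bs : ∀ x v M, x.length ≤ M → (∀ i, v i ≤ M) → ∀ k ≤ f x v,
      ∑ i ∈ Finset.range k, g x (push i v) ≤ (M + 2) ^ (c1 + (c1 + 2) * c2) := by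
    intro x v M hx hv k hk
    refine (Finset.sum_le_card_nsmul _ _ ((M + 2) ^ ((c1 + 2) * c2)) fun i hi =>
      bd x v M hx hv i (by have := Finset.mem_range.1 hi; omega)).trans ?_
    rw [Finset.card_range, smul_eq_mul, pow_add]
    exact Nat.mul_le_mul_right _ (hk.trans (b1 x v M hx hv))
  refine ⟨c1 + (c1 + 2) * c2, fun x v M hx hv => bs x v M hx hv _ le_rfl, fun p b hp => ?_⟩
  obtain ⟨F1, H1⟩ := h1 p (b + 1) fun i => (hp i).trans (Nat.lt_succ_self b)
  obtain ⟨F2, H2⟩ := h2 (push (b + 2) p) (b + 3) fun i => by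
    cases i with
    | zero => simp
    | succ i => have := hp i; simp; omega
  -- Registers: `b` accumulates the sum, `b + 1` holds the number of summands, `b + 2` the summation
  -- variable, `b + 3` the current summand; `b + 4` is auxiliary.
  refine ⟨(F1.seq ((Frag.act (.clr b)).seq (Frag.act (.clr (b + 2))))).seq
    (Frag.loop (.lt (b + 2) (b + 1))
      ((F2.seq (Frag.add b (b + 3) (b + 4))).seq (Frag.act (.inc (b + 2))))),
    fun x M G s hx hs hG => ?_⟩
  obtain ⟨s1, r1, e1, k1, o1⟩ := H1 x M G s hx hs (pow_le_of_le hG (by omega))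
  have p1 : s1.reg ∘ p = s.reg ∘ p := funext fun i => k1 _ ((hp i).trans (Nat.lt_succ_self b))
  set v := s.reg ∘ p with hv
  have hvM : ∀ i, v i ≤ M := hs
  have hfM := b1 x v M hx hvM
  have hadd := add_pow_le M c1
  obtain ⟨s', r', e', k', o'⟩ := Frag.exists_runs_loop (c := .lt (b + 2) (b + 1)) (x := x) (G := G)
    (F := ((F2.seq (Frag.add b (b + 3) (b + 4))).seq (Frag.act (.inc (b + 2)))))
    (s := ⟨Function.update (Function.update s1.reg b 0) (b + 2) 0, s1.pos, s1.output⟩) (f x v)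
    (fun k s' => (s'.reg b = ∑ i ∈ Finset.range k, g x (push i v) ∧ s'.reg (b + 2) = k ∧
      s'.reg (b + 1) = f x v) ∧ (∀ l < b, s'.reg l = s.reg l) ∧ s'.output = s.output)
    (fun k hk s' ⟨⟨a1, a2, a3⟩, a4, a5⟩ => by
      refine ⟨by simp [Cond.eval, a2, a3, hk], ?_⟩
      have pv : s'.reg ∘ push (b + 2) p = push k v := by
        funext i
        cases i with
        | zero => simp [a2]
        | succ i => simp [hv, a4 _ (hp i)]
      obtain ⟨s2, r2, e2, k2, o2⟩ := H2 x (M + (M + 2) ^ c1) G s' (by omega)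
        (fun i => by
          rw [show s'.reg (push (b + 2) p i) = push k v i from congrFun pv i]
          cases i with
          | zero => simp; omega
          | succ j => have := hvM j; simp; omega)
        (le_trans (le_trans (Nat.pow_le_pow_left (by omega) _)
          (le_of_eq (pow_mul (M + 2) (c1 + 2) c2).symm)) (pow_le_of_le hG (by omega)))
      have hsum := bs x v M hx hvM (k + 1) hk
      rw [Finset.sum_range_succ] at hsum
      obtain ⟨s3, r3, e3, k3, o3⟩ := Frag.exists_runs_add (A := A) (x := x) (G := G) (s := s2)
        (i := b) (j := b + 3) (k := b + 4) (by omega) (by omega) (by omega)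
        (by rw [k2 b (by omega), a1, e2, pv]; omega)
      have hp2 : s3.reg (b + 2) = k := by
        rw [k3 _ (by omega) (by omega), k2 _ (by omega), a2]
      refine ⟨_, (r2.seq r3).seq (Frag.runs_inc ?_), ?_⟩
      · rw [hp2]
        have := pow_le_of_le hG (a := c1) (by omega)
        omega
      · refine ⟨⟨?_, ?_, ?_⟩, fun l hl => ?_, by simp [o3, o2, a5]⟩
        · dsimp only; rw [Function.update_of_ne (by omega), e3, e2, k2 b (by omega), a1, pv,
            Finset.sum_range_succ]
        · simp [hp2]
        · dsimp only; rw [Function.update_of_ne (by omega), k3 _ (by omega) (by omega), k2 _ (by omega), a3]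
        · dsimp only; rw [Function.update_of_ne (by omega), k3 _ (by omega) (by omega), k2 _ (by omega),
            a4 l hl])
    (fun s' ⟨⟨a1, a2, a3⟩, _, _⟩ => by simp [Cond.eval, a2, a3])
    ⟨⟨by simp, by simp, by simp [e1]⟩, fun l hl => by
      dsimp only; rw [Function.update_of_ne (by omega), Function.update_of_ne (by omega), k1 l (by omega)], o1⟩
  exact ⟨s', (r1.seq (Frag.runs_clr.seq Frag.runs_clr)).seq r', e'.1, k', o'⟩

/-- Testing the input symbol at a computed position. -/
theorem inp (hf : RegComputable B f) (P : InSym A → Bool) :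
    RegComputable B fun x v => if P (readInput x (f x v)) then 1 else 0 := by
  obtain ⟨c, b1, h1⟩ := hf
  refine ⟨c, fun x v M _ _ => ?_, fun p b hp => ?_⟩
  · have : 1 ≤ (M + 2) ^ c := Nat.one_le_pow _ _ (by omega)
    beta_reduce
    split_ifs <;> omega
  obtain ⟨F, H⟩ := h1 p b hp
  refine ⟨(F.seq ((Frag.act .home).seq (Frag.act (.clr (b + 1))))).seq
    ((Frag.loop (.lt (b + 1) b) ((Frag.act .right).seq (Frag.act (.inc (b + 1))))).seq
      ((Frag.act (.clr b)).seq (Frag.ite (.inp P) (Frag.act (.inc b)) Frag.skip))),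
    fun x M G s hx hs hG => ?_⟩
  obtain ⟨s1, r1, e1, k1, o1⟩ := H x M G s hx hs hG
  have hfM := (b1 x (s.reg ∘ p) M hx hs).trans hG
  have hG1 : 1 ≤ G := (Nat.one_le_pow _ _ (by omega)).trans hG
  obtain ⟨s2, r2, ⟨i1, i2, i3⟩, i4, i5⟩ := Frag.exists_runs_loop (c := .lt (b + 1) b) (x := x)
    (F := (Frag.act .right).seq (Frag.act (.inc (b + 1)))) (G := G)
    (s := ⟨Function.update s1.reg (b + 1) 0, 0, s1.output⟩) (f x (s.reg ∘ p))
    (fun k s' => (s'.pos = min k (x.length + 1) ∧ s'.reg (b + 1) = k ∧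
      s'.reg b = f x (s.reg ∘ p)) ∧ (∀ l < b, s'.reg l = s.reg l) ∧ s'.output = s.output)
    (fun k hk s' ⟨⟨a1, a2, a3⟩, a4, a5⟩ => by
      refine ⟨by simp [Cond.eval, a2, a3, hk], _, Frag.runs_right.seq
        (Frag.runs_inc (by dsimp only; omega)), ⟨?_, ?_, ?_⟩, fun l hl => ?_, a5⟩
      · simp only [a1]; omega
      · simp [a2]
      · simp [a3]
      · dsimp only; rw [Function.update_of_ne (by omega)]; exact a4 l hl)
    (fun s' ⟨⟨a1, a2, a3⟩, _, _⟩ => by simp [Cond.eval, a2, a3])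
    ⟨⟨by simp, by simp, by simp [e1]⟩, fun l hl => by
      dsimp only; rw [Function.update_of_ne (by omega), k1 l (by omega)], o1⟩
  have hread : readInput x s2.pos = readInput x (f x (s.reg ∘ p)) := by
    rw [i1]
    by_cases hle : f x (s.reg ∘ p) ≤ x.length + 1
    · rw [min_eq_left hle]
    · rw [readInput_of_length_lt (by omega), readInput_of_length_lt (by omega)]
  have pre : ∀ {s3}, (Frag.ite (.inp P) (Frag.act (.inc b)) Frag.skip : Frag A B).Runs x G
      ⟨Function.update s2.reg b 0, s2.pos, s2.output⟩ s3 → _ := fun {s3} r3 =>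
    (r1.seq (Frag.runs_home.seq Frag.runs_clr)).seq (r2.seq (Frag.runs_clr.seq r3))
  by_cases hP : P (readInput x (f x (s.reg ∘ p))) = true
  · refine ⟨⟨Function.update s2.reg b 1, s2.pos, s2.output⟩, pre (Frag.Runs.ite ?_), ?_, ?_, i5⟩
    · rw [if_pos (by simpa [Cond.eval, hread] using hP)]
      have := Frag.runs_inc (A := A) (x := x) (G := G) (i := b)
        (s := ⟨Function.update s2.reg b 0, s2.pos, s2.output⟩) (by simp; omega)
      simpa using this
    · simp [hP]
    · intro l hl; dsimp only; rw [Function.update_of_ne (by omega)]; exact i4 l hl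
  · refine ⟨⟨Function.update s2.reg b 0, s2.pos, s2.output⟩, pre (Frag.Runs.ite ?_), ?_, ?_, i5⟩
    · rw [if_neg (by simpa [Cond.eval, hread] using hP)]
      exact Frag.runs_skip
    · simp [hP]
    · intro l hl; dsimp only; rw [Function.update_of_ne (by omega)]; exact i4 l hl

open Classical in
/-- The length of the input. -/
theorem length : RegComputable B fun (x : List A) _ => x.length := by
  refine ⟨1, fun x v M hx _ => by simp; omega, fun p b hp => ?_⟩
  refine ⟨((Frag.act .home).seq ((Frag.act .right).seq (Frag.act (.clr b)))).seq
    (Frag.loop (.inp fun a => decide (a ≠ .rightEnd))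
      ((Frag.act .right).seq (Frag.act (.inc b)))), fun x M G s hx hs hG => ?_⟩
  rw [pow_one] at hG
  obtain ⟨s2, r2, ⟨i1, i2⟩, i4, i5⟩ := Frag.exists_runs_loop
    (c := .inp fun a => decide (a ≠ .rightEnd)) (x := x)
    (F := (Frag.act .right).seq (Frag.act (.inc b))) (G := G)
    (s := ⟨Function.update s.reg b 0, 1, s.output⟩) x.length
    (fun k s' => (s'.pos = k + 1 ∧ s'.reg b = k) ∧ (∀ l < b, s'.reg l = s.reg l) ∧
      s'.output = s.output)
    (fun k hk s' ⟨⟨a1, a2⟩, a4, a5⟩ => by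
      refine ⟨?_, _, Frag.runs_right.seq
        (Frag.runs_inc (by dsimp only; omega)), ⟨?_, ?_⟩, fun l hl => ?_, a5⟩
      · simp only [Cond.eval, a1, ne_eq, readInput_eq_rightEnd_iff]
        simpa using hk
      · simp only [a1]; omega
      · simp [a2]
      · dsimp only; rw [Function.update_of_ne (by omega)]; exact a4 l hl)
    (fun s' ⟨⟨a1, a2⟩, _, _⟩ => by
      simp [Cond.eval, a1, readInput_eq_rightEnd_iff])
    ⟨⟨rfl, by simp⟩, fun l hl => by
      dsimp only; rw [Function.update_of_ne (by omega)], rfl⟩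
  refine ⟨s2, Frag.Runs.seq (Frag.runs_home.seq (Frag.runs_right.seq Frag.runs_clr)) ?_, i2, i4, i5⟩
  simpa using r2

end RegComputable

end RegMachine

/-! ### Arithmetic on register machines -/

namespace RegMachine

open Relation

variable {A B : Type}

/-- A predicate on the input and an environment that structured programs can test. -/
def RegPred (B : Type) (P : List A → (ℕ → ℕ) → Prop) : Prop :=
  ∃ f, RegComputable B f ∧ ∀ x v, P x v ↔ 0 < f x v

namespace RegComputable

variable {f g h k : List A → (ℕ → ℕ) → ℕ} {P P' : List A → (ℕ → ℕ) → Prop}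

theorem ite [∀ x v, Decidable (P x v)] (hP : RegPred B P) (hf : RegComputable B f)
    (hg : RegComputable B g) : RegComputable B fun x v => if P x v then f x v else g x v := by
  obtain ⟨t, ht, e⟩ := hP
  exact (ite_lt (const 0) ht hf hg).congr fun x v => by simp only [e]

theorem add (hf : RegComputable B f) (hg : RegComputable B g) :
    RegComputable B fun x v => f x v + g x v :=
  (sum (const 2) (ite_lt (var 0) (const 1) hf.shift hg.shift)).congr fun x v => by
    simp [Finset.sum_range_succ]

theorem mul (hf : RegComputable B f) (hg : RegComputable B g) :
    RegComputable B fun x v => f x v * g x v :=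
  (sum hf hg.shift).congr fun x v => by simp

theorem pow (hf : RegComputable B f) (n : ℕ) : RegComputable B fun x v => f x v ^ n := by
  induction n with
  | zero => exact (const 1).congr fun x v => by simp
  | succ n ih => exact (ih.mul hf).congr fun x v => pow_succ _ _

/-- The truncated difference `m - n` counts the `i < m` with `n ≤ i`. -/
theorem sub (hf : RegComputable B f) (hg : RegComputable B g) :
    RegComputable B fun x v => f x v - g x v :=
  (sum hf (ite_lt (var 0) hg.shift (const 0) (const 1))).congr fun x v => by
    change f x v - g x v = ∑ i ∈ Finset.range (f x v), if i < g x v then 0 else 1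
    generalize f x v = m
    generalize g x v = n
    induction m with
    | zero => simp
    | succ m ih => rw [Finset.sum_range_succ, ← ih]; split_ifs <;> omega

/-- The quotient `m / n` counts the `i < m` with `(i + 1) n ≤ m`. -/
theorem div (hf : RegComputable B f) (hg : RegComputable B g) :
    RegComputable B fun x v => f x v / g x v :=
  (ite_lt (const 0) hg (sum hf (ite_lt hf.shift (((var 0).add (const 1)).mul hg.shift)
    (const 0) (const 1))) (const 0)).congr fun x v => by
    change f x v / g x v = if 0 < g x v then
      ∑ i ∈ Finset.range (f x v), (if f x v < (i + 1) * g x v then 0 else 1) else 0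
    generalize f x v = m
    generalize g x v = n
    rcases Nat.eq_zero_or_pos n with rfl | hn
    · simp
    · have key : ∀ j, ∑ i ∈ Finset.range j, (if m < (i + 1) * n then 0 else 1) = min j (m / n) := by
        intro j
        induction j with
        | zero => simp
        | succ j ih =>
          rw [Finset.sum_range_succ, ih]
          have := Nat.le_div_iff_mul_le (x := j + 1) (y := m) hn
          split_ifs <;> omega
      rw [if_pos hn, key, min_eq_right (Nat.div_le_self m n)]

theorem mod (hf : RegComputable B f) (hg : RegComputable B g) :
    RegComputable B fun x v => f x v % g x v :=
  (hf.sub (hg.mul (hf.div hg))).congr fun _ _ => Nat.mod_eq_sub _ _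

theorem finset_sum {ι : Type} (S : Finset ι) {F : ι → List A → (ℕ → ℕ) → ℕ}
    (hF : ∀ i, RegComputable B (F i)) : RegComputable B fun x v => ∑ i ∈ S, F i x v := by
  classical
  induction S using Finset.induction_on with
  | empty => exact (const 0).congr fun x v => by simp
  | insert i S hi ih => exact ((hF i).add ih).congr fun x v => by simp [hi]

end RegComputable

namespace RegPred

variable {f g : List A → (ℕ → ℕ) → ℕ} {P P' : List A → (ℕ → ℕ) → Prop}

theorem congr (hP : RegPred B P) (e : ∀ x v, P' x v ↔ P x v) : RegPred B P' := by
  obtain ⟨f, hf, h⟩ := hP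
  exact ⟨f, hf, fun x v => (e x v).trans (h x v)⟩

theorem lt (hf : RegComputable B f) (hg : RegComputable B g) :
    RegPred B fun x v => f x v < g x v :=
  ⟨_, RegComputable.ite_lt hf hg (.const 1) (.const 0), fun x v => by
    dsimp only; split_ifs <;> simp_all⟩

theorem not (hP : RegPred B P) : RegPred B fun x v => ¬ P x v := by
  obtain ⟨f, hf, h⟩ := hP
  exact (lt hf (.const 1)).congr fun x v => by rw [h]; omega

theorem and (hP : RegPred B P) (hP' : RegPred B P') : RegPred B fun x v => P x v ∧ P' x v := by
  obtain ⟨f, hf, h⟩ := hP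
  obtain ⟨f', hf', h'⟩ := hP'
  exact ⟨_, hf.mul hf', fun x v => by simp only [h, h', Nat.pos_iff_ne_zero, mul_ne_zero_iff]⟩

theorem eq (hf : RegComputable B f) (hg : RegComputable B g) :
    RegPred B fun x v => f x v = g x v :=
  ((lt hf hg).not.and (lt hg hf).not).congr fun x v => by omega

theorem inp (hf : RegComputable B f) (Q : InSym A → Prop) :
    RegPred B fun x v => Q (readInput x (f x v)) := by
  classical
  exact ⟨_, hf.inp fun a => decide (Q a), fun x v => by simp; split_ifs <;> simp_all⟩

theorem forall_mem {ι : Type} (S : Finset ι) {F : ι → List A → (ℕ → ℕ) → Prop}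
    (hF : ∀ i, RegPred B (F i)) : RegPred B fun x v => ∀ i ∈ S, F i x v := by
  classical
  induction S using Finset.induction_on with
  | empty => exact ⟨_, .const 1, fun x v => by simp⟩
  | insert i S hi ih => exact ((hF i).and ih).congr fun x v => by simp

end RegPred

/-! ### Words produced by register machines -/

/-- The word `o x v`, which depends on the input and on an environment, is produced by a structured
program with polynomially bounded registers; the conventions are those of `RegComputable`. -/
def RegOutput (o : List A → (ℕ → ℕ) → List B) : Prop :=
  ∃ c : ℕ, ∀ (p : ℕ → ℕ) (b : ℕ), (∀ i, p i < b) → ∃ F : Frag A B, ∀ x M G s,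
      x.length ≤ M → (∀ i, s.reg (p i) ≤ M) → (M + 2) ^ c ≤ G →
      ∃ s', F.Runs x G s s' ∧ (∀ i < b, s'.reg i = s.reg i) ∧
        s'.output = s.output ++ o x (s.reg ∘ p)

namespace RegOutput

variable {f g : List A → (ℕ → ℕ) → ℕ} {o o' : List A → (ℕ → ℕ) → List B}
  {P : List A → (ℕ → ℕ) → Prop}

theorem congr (ho : RegOutput o) (e : ∀ x v, o' x v = o x v) : RegOutput o' := by
  obtain rfl : o' = o := funext fun x => funext fun v => e x v
  exact ho

theorem nil : RegOutput fun (_ : List A) _ => ([] : List B) :=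
  ⟨0, fun _ _ _ => ⟨Frag.skip, fun _ _ _ s _ _ _ => ⟨s, Frag.runs_skip, fun _ _ => rfl, by simp⟩⟩⟩

theorem single (a : B) : RegOutput fun (_ : List A) _ => [a] :=
  ⟨0, fun _ _ _ => ⟨Frag.act (.out a), fun _ _ _ _ _ _ _ =>
    ⟨_, Frag.runs_act rfl, fun _ _ => rfl, rfl⟩⟩⟩

theorem append (ho : RegOutput o) (ho' : RegOutput o') :
    RegOutput fun x v => o x v ++ o' x v := by
  obtain ⟨c1, h1⟩ := ho
  obtain ⟨c2, h2⟩ := ho'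
  refine ⟨c1 + c2, fun p b hp => ?_⟩
  obtain ⟨F1, H1⟩ := h1 p b hp
  obtain ⟨F2, H2⟩ := h2 p b hp
  refine ⟨F1.seq F2, fun x M G s hx hs hG => ?_⟩
  obtain ⟨s1, r1, k1, o1⟩ := H1 x M G s hx hs (pow_le_of_le hG (by omega))
  obtain ⟨s2, r2, k2, o2⟩ := H2 x M G s1 hx (fun i => by rw [k1 _ (hp i)]; exact hs i)
    (pow_le_of_le hG (by omega))
  have p1 : s1.reg ∘ p = s.reg ∘ p := funext fun i => k1 _ (hp i)
  exact ⟨s2, r1.seq r2, fun i hi => (k2 i hi).trans (k1 i hi), by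
    rw [o2, o1, p1, List.append_assoc]⟩

theorem const (l : List B) : RegOutput fun (_ : List A) _ => l := by
  induction l with
  | nil => exact nil
  | cons a l ih => exact (single a).append ih

theorem ite [∀ x v, Decidable (P x v)] (hP : RegPred B P) (ho : RegOutput o)
    (ho' : RegOutput o') : RegOutput fun x v => if P x v then o x v else o' x v := by
  obtain ⟨t, ⟨c0, b0, h0⟩, e⟩ := hP
  obtain ⟨c1, h1⟩ := ho
  obtain ⟨c2, h2⟩ := ho'
  refine ⟨c0 + c1 + c2, fun p b hp => ?_⟩
  obtain ⟨F0, H0⟩ := h0 p b hp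
  obtain ⟨F1, H1⟩ := h1 p b hp
  obtain ⟨F2, H2⟩ := h2 p b hp
  refine ⟨F0.seq ((Frag.act (.clr (b + 1))).seq (Frag.ite (.lt (b + 1) b) F1 F2)),
    fun x M G s hx hs hG => ?_⟩
  obtain ⟨s0, r0, e0, k0, o0⟩ := H0 x M G s hx hs (pow_le_of_le hG (by omega))
  have k0' : ∀ i < b, Function.update s0.reg (b + 1) 0 i = s.reg i := fun i hi => by
    rw [Function.update_of_ne (by omega), k0 i hi]
  have p0 : Function.update s0.reg (b + 1) 0 ∘ p = s.reg ∘ p := funext fun i => k0' _ (hp i)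
  have hs0 : ∀ i, Function.update s0.reg (b + 1) 0 (p i) ≤ M := fun i => by
    rw [k0' _ (hp i)]; exact hs i
  have hc : (Cond.lt (b + 1) b : Cond A).eval x
      ⟨Function.update s0.reg (b + 1) 0, s0.pos, s0.output⟩ = decide (P x (s.reg ∘ p)) := by
    simp [Cond.eval, e0, e]
  by_cases hP : P x (s.reg ∘ p)
  · obtain ⟨s1, r1, k1, o1⟩ := H1 x M G
      ⟨Function.update s0.reg (b + 1) 0, s0.pos, s0.output⟩ hx hs0 (pow_le_of_le hG (by omega))
    exact ⟨s1, r0.seq (Frag.runs_clr.seq (Frag.Runs.ite (by simpa [hc, hP] using r1))),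
      fun i hi => (k1 i hi).trans (k0' i hi), by rw [o1, p0, o0]; simp [hP]⟩
  · obtain ⟨s1, r1, k1, o1⟩ := H2 x M G
      ⟨Function.update s0.reg (b + 1) 0, s0.pos, s0.output⟩ hx hs0 (pow_le_of_le hG (by omega))
    exact ⟨s1, r0.seq (Frag.runs_clr.seq (Frag.Runs.ite (by simpa [hc, hP] using r1))),
      fun i hi => (k1 i hi).trans (k0' i hi), by rw [o1, p0, o0]; simp [hP]⟩

/-- Concatenation over a bounded variable. -/
theorem flatMap (hf : RegComputable B f) (ho : RegOutput o) :
    RegOutput fun x v => (List.range (f x v)).flatMap fun i => o x (push i v) := by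
  obtain ⟨c1, b1, h1⟩ := hf
  obtain ⟨c2, h2⟩ := ho
  refine ⟨c1 + (c1 + 2) * c2, fun p b hp => ?_⟩
  obtain ⟨F1, H1⟩ := h1 p b hp
  obtain ⟨F2, H2⟩ := h2 (push (b + 1) p) (b + 2) fun i => by
    cases i with
    | zero => simp
    | succ i => have := hp i; simp; omega
  refine ⟨(F1.seq (Frag.act (.clr (b + 1)))).seq
    (Frag.loop (.lt (b + 1) b) (F2.seq (Frag.act (.inc (b + 1))))),
    fun x M G s hx hs hG => ?_⟩
  obtain ⟨s1, r1, e1, k1, o1⟩ := H1 x M G s hx hs (pow_le_of_le hG (by omega))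
  set v := s.reg ∘ p with hv
  have hvM : ∀ i, v i ≤ M := hs
  have hfM := b1 x v M hx hvM
  have hadd := add_pow_le M c1
  obtain ⟨s', r', e', k', o'⟩ := Frag.exists_runs_loop (c := .lt (b + 1) b) (x := x) (G := G)
    (F := F2.seq (Frag.act (.inc (b + 1))))
    (s := ⟨Function.update s1.reg (b + 1) 0, s1.pos, s1.output⟩) (f x v)
    (fun k s' => (s'.reg (b + 1) = k ∧ s'.reg b = f x v) ∧ (∀ l < b, s'.reg l = s.reg l) ∧
      s'.output = s.output ++ (List.range k).flatMap fun i => o x (push i v))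
    (fun k hk s' ⟨⟨a2, a3⟩, a4, a5⟩ => by
      refine ⟨by simp [Cond.eval, a2, a3, hk], ?_⟩
      have pv : s'.reg ∘ push (b + 1) p = push k v := by
        funext i
        cases i with
        | zero => simp [a2]
        | succ i => simp [hv, a4 _ (hp i)]
      obtain ⟨s2, r2, k2, o2⟩ := H2 x (M + (M + 2) ^ c1) G s' (by omega)
        (fun i => by
          rw [show s'.reg (push (b + 1) p i) = push k v i from congrFun pv i]
          cases i with
          | zero => simp; omega
          | succ j => have := hvM j; simp; omega)
        (le_trans (le_trans (Nat.pow_le_pow_left (by omega) _)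
          (le_of_eq (pow_mul (M + 2) (c1 + 2) c2).symm)) (pow_le_of_le hG (by omega)))
      have hp2 : s2.reg (b + 1) = k := by rw [k2 _ (by omega), a2]
      refine ⟨_, r2.seq (Frag.runs_inc ?_), ⟨?_, ?_⟩, fun l hl => ?_, ?_⟩
      · rw [hp2]
        have := pow_le_of_le hG (a := c1) (by omega)
        omega
      · simp [hp2]
      · dsimp only; rw [Function.update_of_ne (by omega), k2 _ (by omega), a3]
      · dsimp only; rw [Function.update_of_ne (by omega), k2 _ (by omega), a4 l hl]
      · dsimp only; rw [o2, a5, pv]; simp [List.range_succ])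
    (fun s' ⟨⟨a2, a3⟩, _, _⟩ => by simp [Cond.eval, a2, a3])
    ⟨⟨by simp, by simp [e1]⟩, fun l hl => by
      dsimp only; rw [Function.update_of_ne (by omega), k1 l (by omega)], by simp [o1]⟩
  exact ⟨s', (r1.seq Frag.runs_clr).seq r', k', o'⟩

/-- A word produced by a structured program in an environment of zeros is logspace computable. -/
theorem logspaceComputable (ho : RegOutput o) : LogspaceComputable fun x => o x fun _ => 0 := by
  obtain ⟨c, h⟩ := ho
  obtain ⟨F, H⟩ := h (fun _ => 0) 1 (by simp)
  have := F.fin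
  refine logspaceComputable_of_program
    (fun q : Option F.X => q.elim .halt F.code) F.entry _ c fun x => ?_
  obtain ⟨s', r, -, e⟩ := H x x.length _ ⟨fun _ => 0, 0, []⟩ le_rfl (by simp) le_rfl
  refine ⟨none, s', r _ _ id fun y => ?_, rfl, by simpa [Function.comp_def] using e⟩
  cases h : F.code y <;> simp [Instr.map, h]

end RegOutput

end RegMachine

/-! ### Branching systems -/

namespace Branching

variable {S τ : Type} (nx : S → Finset τ) (ap : S → τ → S) (sg : S → ℤ)

/-- All branches from `a` end within `t` steps; `nx a` is the set of moves that are possible in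
`a`, and the move `i` leads to `ap a i`. -/
def HaltsIn : ℕ → S → Prop
  | 0, a => nx a = ∅
  | t + 1, a => ∀ i ∈ nx a, HaltsIn t (ap a i)

open Classical in
/-- The sum of the signs `sg` of the ends of all branches from `a` of length at most `t`. -/
noncomputable def value : ℕ → S → ℤ
  | 0, a => if nx a = ∅ then sg a else 0
  | t + 1, a => if nx a = ∅ then sg a else ∑ i ∈ nx a, value t (ap a i)

variable {nx ap sg}

theorem HaltsIn.succ {t : ℕ} {a : S} (h : HaltsIn nx ap t a) : HaltsIn nx ap (t + 1) a := by
  induction t generalizing a with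
  | zero =>
    intro i hi
    rw [HaltsIn] at h
    rw [h] at hi
    exact absurd hi (Finset.notMem_empty i)
  | succ t ih => exact fun i hi => ih (h i hi)

theorem HaltsIn.mono {t t' : ℕ} {a : S} (h : HaltsIn nx ap t a) (ht : t ≤ t') :
    HaltsIn nx ap t' a := by
  induction t', ht using Nat.le_induction with
  | base => exact h
  | succ t' _ ih => exact ih.succ

theorem value_of_empty {t : ℕ} {a : S} (h : nx a = ∅) : value nx ap sg t a = sg a := by
  cases t <;> simp [value, h]

theorem value_succ_of_ne {t : ℕ} {a : S} (h : nx a ≠ ∅) :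
    value nx ap sg (t + 1) a = ∑ i ∈ nx a, value nx ap sg t (ap a i) := by
  simp [value, h]

theorem HaltsIn.value_succ {t : ℕ} {a : S} (h : HaltsIn nx ap t a) :
    value nx ap sg (t + 1) a = value nx ap sg t a := by
  induction t generalizing a with
  | zero => rw [value_of_empty h, value_of_empty h]
  | succ t ih =>
    by_cases he : nx a = ∅
    · rw [value_of_empty he, value_of_empty he]
    · rw [value_succ_of_ne he, value_succ_of_ne he]
      exact Finset.sum_congr rfl fun i hi => ih (h i hi)

theorem HaltsIn.value_eq {t t' : ℕ} {a : S} (h : HaltsIn nx ap t a) (ht : t ≤ t') :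
    value nx ap sg t' a = value nx ap sg t a := by
  induction t', ht using Nat.le_induction with
  | base => rfl
  | succ t' ht ih => rw [(h.mono ht).value_succ, ih]

/-- Below a state of height `t` there are states of all smaller heights. -/
theorem exists_height {Good : S → Prop} (hG : ∀ a, Good a → ∀ i ∈ nx a, Good (ap a i)) {t : ℕ}
    {a : S} (ha : Good a) (h : HaltsIn nx ap t a) (hm : ∀ s < t, ¬ HaltsIn nx ap s a) :
    ∀ s ≤ t, ∃ b, Good b ∧ HaltsIn nx ap s b ∧ ∀ s' < s, ¬ HaltsIn nx ap s' b := by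
  induction t generalizing a with
  | zero =>
    intro s hs
    obtain rfl : s = 0 := by omega
    exact ⟨a, ha, h, hm⟩
  | succ t ih =>
    intro s hs
    rcases Nat.lt_or_eq_of_le hs with hs | rfl
    · have h1 := hm t (Nat.lt_succ_self t)
      obtain ⟨i, hi, hb⟩ : ∃ i ∈ nx a, ∀ s < t, ¬ HaltsIn nx ap s (ap a i) := by
        cases t with
        | zero =>
          obtain ⟨i, hi⟩ := Finset.nonempty_iff_ne_empty.2 h1
          exact ⟨i, hi, fun s hs => absurd hs (Nat.not_lt_zero s)⟩
        | succ t =>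
          simp only [HaltsIn, not_forall] at h1
          obtain ⟨i, hi, h2⟩ := h1
          exact ⟨i, hi, fun s hs h3 => h2 (h3.mono (by omega))⟩
      exact ih (hG a ha i hi) (h i hi) hb s (by omega)
    · exact ⟨a, ha, h, hm⟩

/-- In a system with at most `N` states every branch that ends has length less than `N`: otherwise
it would pass through a state twice. -/
theorem HaltsIn.exists_lt {nx : ℕ → Finset τ} {ap : ℕ → τ → ℕ} {Good : ℕ → Prop} {N : ℕ}
    (hN : ∀ a, Good a → a < N) (hG : ∀ a, Good a → ∀ i ∈ nx a, Good (ap a i)) {t a : ℕ}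
    (ha : Good a) (h : HaltsIn nx ap t a) : ∃ s < N, HaltsIn nx ap s a := by
  classical
  have hex : ∃ t, HaltsIn nx ap t a := ⟨t, h⟩
  refine ⟨Nat.find hex, ?_, Nat.find_spec hex⟩
  have key := exists_height hG ha (Nat.find_spec hex) fun s hs => Nat.find_min hex hs
  choose f hf using fun s : Fin (Nat.find hex + 1) => key s (Nat.lt_succ_iff.1 s.2)
  have hinj : Function.Injective fun s => (⟨f s, hN _ (hf s).1⟩ : Fin N) := by
    intro s s' e
    have e' : f s = f s' := congrArg Fin.val e
    rcases lt_trichotomy s.1 s'.1 with hlt | heq | hlt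
    · exact absurd (e' ▸ (hf s).2.1) ((hf s').2.2 s hlt)
    · exact Fin.ext heq
    · exact absurd (e' ▸ (hf s').2.1) ((hf s).2.2 s' hlt)
  have := Fintype.card_le_of_injective _ hinj
  simpa using this

/-! ### Computing values by products of row operations -/

/-- The matrix that replaces the row `a` of the identity by the successors of `a`. The entries are
shifted by one, so that they are given by a function `E` with natural values; the row of the state
`fin`, which collects the results, is never replaced. -/
def rowMatrix (N fin : ℕ) (E : ℕ → ℕ → ℕ) (a : ℕ) : Matrix (Fin N) (Fin N) ℚ := fun r c =>
  ((if r.1 = a ∧ a ≠ fin then E a c.1 else if r.1 = c.1 then 2 else 1 : ℕ) : ℚ) - 1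

/-- `N` rounds in each of which all the rows are replaced once. -/
def matrices (N fin : ℕ) (E : ℕ → ℕ → ℕ) : List (Matrix (Fin N) (Fin N) ℚ) :=
  (List.range N).flatMap fun _ => (List.range N).map (rowMatrix N fin E)

theorem exists_of_mem_matrices {N fin : ℕ} {E : ℕ → ℕ → ℕ} {A : Matrix (Fin N) (Fin N) ℚ}
    (hA : A ∈ matrices N fin E) : ∃ a < N, rowMatrix N fin E a = A := by
  obtain ⟨-, -, h⟩ := List.mem_flatMap.1 hA
  simpa using h

section Product

open Matrix

variable {nx : ℕ → Finset τ} {ap : ℕ → τ → ℕ} {sg : ℕ → ℤ} {Good : ℕ → Prop} {N fin : ℕ}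
  {E : ℕ → ℕ → ℕ}

/-- States from which all branches end in fewer than `m` steps. -/
def Level (nx : ℕ → Finset τ) (ap : ℕ → τ → ℕ) (Good : ℕ → Prop) : ℕ → ℕ → Prop
  | 0, _ => False
  | m + 1, a => Good a ∧ HaltsIn nx ap m a

theorem Level.succ {m a : ℕ} (h : Level nx ap Good m a) : Level nx ap Good (m + 1) a := by
  cases m with
  | zero => exact h.elim
  | succ m => exact ⟨h.1, h.2.succ⟩

theorem Level.mono {m m' a : ℕ} (h : Level nx ap Good m a) (hm : m ≤ m') :
    Level nx ap Good m' a := by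
  induction m', hm using Nat.le_induction with
  | base => exact h
  | succ m' _ ih => exact ih.succ

/-- The values of the states, as a column vector. -/
noncomputable def valueVec (nx : ℕ → Finset τ) (ap : ℕ → τ → ℕ) (sg : ℕ → ℤ) (N fin : ℕ) :
    Fin N → ℚ :=
  fun c => if c.1 = fin then 1 else (value nx ap sg N c.1 : ℚ)

/-- The entries of `rowMatrix` in the rows of the relevant states. -/
def IsWeight (nx : ℕ → Finset τ) (ap : ℕ → τ → ℕ) (sg : ℕ → ℤ) (Good : ℕ → Prop) (fin : ℕ)
    (E : ℕ → ℕ → ℕ) : Prop :=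
  ∀ a, Good a → (nx a = ∅ → ∀ c, (E a c : ℤ) - 1 = if c = fin then sg a else 0) ∧
    (nx a ≠ ∅ → ∀ c, (E a c : ℤ) - 1 = ∑ i ∈ nx a, if ap a i = c then 1 else 0)

theorem rowMatrix_of_eq {a : ℕ} {r c : Fin N} (hr : r.1 = a) (ha : a ≠ fin) :
    rowMatrix N fin E a r c = (((E a c.1 : ℤ) - 1 : ℤ) : ℚ) := by
  simp [rowMatrix, hr, ha]

theorem rowMatrix_of_ne {a : ℕ} {r c : Fin N} (h : r.1 ≠ a ∨ a = fin) :
    rowMatrix N fin E a r c = if r = c then 1 else 0 := by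
  have : ¬ (r.1 = a ∧ a ≠ fin) := by tauto
  rw [rowMatrix, if_neg this]
  by_cases e : r = c
  · simp [e]; norm_num
  · have : r.1 ≠ c.1 := fun h => e (Fin.ext h)
    simp [e, this]

/-- Replacing a row does not change the total value, since the value of a state is the sum of the
values of its successors. -/
theorem rowMatrix_mulVec (hN : ∀ a, Good a → a < N ∧ a ≠ fin) (hfin : fin < N)
    (hG : ∀ a, Good a → ∀ i ∈ nx a, Good (ap a i)) (hE : IsWeight nx ap sg Good fin E)
    {a : ℕ} {r : Fin N} (h : r.1 = a → a ≠ fin → Level nx ap Good (N + 1) a) :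
    (rowMatrix N fin E a *ᵥ valueVec nx ap sg N fin) r = valueVec nx ap sg N fin r := by
  by_cases hr : r.1 = a ∧ a ≠ fin
  · obtain ⟨rfl, ha⟩ := hr
    obtain ⟨hg, hh⟩ := h rfl ha
    simp only [mulVec, dotProduct, rowMatrix_of_eq rfl ha]
    rw [valueVec, if_neg ha]
    by_cases he : nx r.1 = ∅
    · rw [value_of_empty he, Finset.sum_eq_single (⟨fin, hfin⟩ : Fin N)]
      · simp [(hE _ hg).1 he, valueVec]
      · intro c _ hc
        have : c.1 ≠ fin := fun e => hc (Fin.ext e)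
        rw [(hE _ hg).1 he, if_neg this]
        simp
      · simp
    · rw [← hh.value_succ, value_succ_of_ne he]
      simp only [(hE _ hg).2 he, Int.cast_sum, Finset.sum_mul]
      rw [Finset.sum_comm]
      refine Finset.sum_congr rfl fun i hi => ?_
      have hgi := hG _ hg i hi
      rw [Finset.sum_eq_single (⟨ap r.1 i, (hN _ hgi).1⟩ : Fin N)]
      · simp [valueVec, (hN _ hgi).2]
      · intro c _ hc
        have : ap r.1 i ≠ c.1 := fun e => hc (Fin.ext e.symm)
        simp [this]
      · simp
  · have h' : r.1 ≠ a ∨ a = fin := by tauto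
    simp [mulVec, dotProduct, rowMatrix_of_ne h']

/-- The successors in a replaced row have smaller height. -/
theorem exists_of_rowMatrix_ne_zero (hE : IsWeight nx ap sg Good fin E) {m a : ℕ} {r c : Fin N}
    (hG : ∀ a, Good a → ∀ i ∈ nx a, Good (ap a i))
    (hr : r.1 = a) (ha : a ≠ fin) (hl : Level nx ap Good (m + 1) a)
    (h : rowMatrix N fin E a r c ≠ 0) : c.1 = fin ∨ Level nx ap Good m c := by
  rw [rowMatrix_of_eq hr ha, Int.cast_ne_zero] at h
  by_cases he : nx a = ∅
  · rw [(hE _ hl.1).1 he] at h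
    left
    by_contra hc
    simp [hc] at h
  · right
    rw [(hE _ hl.1).2 he] at h
    obtain ⟨i, hi, h1⟩ := Finset.exists_ne_zero_of_sum_ne_zero h
    have h2 : ap a i = c.1 := by
      by_contra hc
      simp [hc] at h1
    cases m with
    | zero => exact absurd hl.2 he
    | succ m => exact h2 ▸ ⟨hG _ hl.1 i hi, hl.2 i hi⟩

/-- One factor within a round. After the factors `0, …, j - 1`, the vector may still have entries of
the height from before the round, but only at indices from `j` on. -/
theorem vecMul_rowMatrix (hN : ∀ a, Good a → a < N ∧ a ≠ fin) (hfin : fin < N)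
    (hG : ∀ a, Good a → ∀ i ∈ nx a, Good (ap a i)) (hE : IsWeight nx ap sg Good fin E)
    {m j : ℕ} (hm : m ≤ N) {u : Fin N → ℚ} (h : ∀ c : Fin N, u c ≠ 0 →
      c.1 = fin ∨ Level nx ap Good m c ∨ (Level nx ap Good (m + 1) c ∧ j ≤ c.1)) :
    (∀ c : Fin N, (u ᵥ* rowMatrix N fin E j) c ≠ 0 →
      c.1 = fin ∨ Level nx ap Good m c ∨ (Level nx ap Good (m + 1) c ∧ j + 1 ≤ c.1)) ∧
    (u ᵥ* rowMatrix N fin E j) ⬝ᵥ valueVec nx ap sg N fin = u ⬝ᵥ valueVec nx ap sg N fin := by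
  constructor
  · intro c hc
    simp only [vecMul, dotProduct] at hc
    obtain ⟨r, -, hr⟩ := Finset.exists_ne_zero_of_sum_ne_zero hc
    obtain ⟨h1, h2⟩ := mul_ne_zero_iff.1 hr
    by_cases hj : r.1 = j ∧ j ≠ fin
    · have hl : Level nx ap Good (m + 1) j := by
        rcases h r h1 with h3 | h3 | h3
        · exact absurd (hj.1.symm.trans h3) hj.2
        · exact hj.1 ▸ h3.succ
        · exact hj.1 ▸ h3.1
      rcases exists_of_rowMatrix_ne_zero hE hG hj.1 hj.2 hl h2 with h3 | h3
      · exact .inl h3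
      · exact .inr (.inl h3)
    · have h' : r.1 ≠ j ∨ j = fin := by tauto
      rw [rowMatrix_of_ne h'] at h2
      obtain rfl : r = c := by
        by_contra e
        simp [e] at h2
      rcases h r h1 with h3 | h3 | ⟨h3, h4⟩
      · exact .inl h3
      · exact .inr (.inl h3)
      · by_cases e : r.1 = fin
        · exact .inl e
        · exact .inr (.inr ⟨h3, by
            rcases h' with h' | h'
            · omega
            · omega⟩)
  · rw [← dotProduct_mulVec]
    refine Finset.sum_congr rfl fun r _ => ?_
    by_cases hu : u r = 0
    · simp [hu]
    · congr 1
      refine rowMatrix_mulVec hN hfin hG hE fun hr hj => ?_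
      rcases h r hu with h3 | h3 | h3
      · exact absurd (hr.symm.trans h3) hj
      · exact hr ▸ h3.mono (by omega)
      · exact hr ▸ h3.1.mono (by omega)

/-- A round lowers the height of the support of a vector by one and preserves its total value. -/
theorem vecMul_round (hN : ∀ a, Good a → a < N ∧ a ≠ fin) (hfin : fin < N)
    (hG : ∀ a, Good a → ∀ i ∈ nx a, Good (ap a i)) (hE : IsWeight nx ap sg Good fin E)
    {m : ℕ} (hm : m ≤ N) {u : Fin N → ℚ} (h : ∀ c : Fin N, u c ≠ 0 →
      c.1 = fin ∨ Level nx ap Good (m + 1) c) :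
    (∀ c : Fin N, (u ᵥ* ((List.range N).map (rowMatrix N fin E)).prod) c ≠ 0 →
      c.1 = fin ∨ Level nx ap Good m c) ∧
    (u ᵥ* ((List.range N).map (rowMatrix N fin E)).prod) ⬝ᵥ valueVec nx ap sg N fin =
      u ⬝ᵥ valueVec nx ap sg N fin := by
  have key : ∀ j, (∀ c : Fin N, (u ᵥ* ((List.range j).map (rowMatrix N fin E)).prod) c ≠ 0 →
      c.1 = fin ∨ Level nx ap Good m c ∨ (Level nx ap Good (m + 1) c ∧ j ≤ c.1)) ∧
    (u ᵥ* ((List.range j).map (rowMatrix N fin E)).prod) ⬝ᵥ valueVec nx ap sg N fin =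
      u ⬝ᵥ valueVec nx ap sg N fin := by
    intro j
    induction j with
    | zero =>
      simp only [List.range_zero, List.map_nil, List.prod_nil, vecMul_one]
      refine ⟨fun c hc => ?_, trivial⟩
      rcases h c hc with h | h
      · exact .inl h
      · exact .inr (.inr ⟨h, Nat.zero_le _⟩)
    | succ j ih =>
      rw [List.range_succ, List.map_append, List.prod_append, List.map_singleton,
        List.prod_singleton, ← vecMul_vecMul]
      obtain ⟨h1, h2⟩ := vecMul_rowMatrix hN hfin hG hE hm ih.1
      exact ⟨h1, h2.trans ih.2⟩
  refine ⟨fun c hc => ?_, (key N).2⟩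
  rcases (key N).1 c hc with h | h | h
  · exact .inl h
  · exact .inr h
  · exact absurd c.2 (not_lt.2 h.2)

/-- The product of the matrices moves each branch to its end, and collects the signs there. -/
theorem prod_matrices_apply (hN : ∀ a, Good a → a < N ∧ a ≠ fin) (hfin : fin < N)
    (hG : ∀ a, Good a → ∀ i ∈ nx a, Good (ap a i)) (hE : IsWeight nx ap sg Good fin E)
    {a : ℕ} (ha : Good a) {t : ℕ} (ht : HaltsIn nx ap t a) :
    (matrices N fin E).prod ⟨a, (hN a ha).1⟩ ⟨fin, hfin⟩ = (value nx ap sg t a : ℚ) := by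
  obtain ⟨s, hs, hsa⟩ := ht.exists_lt (fun a h => (hN a h).1) hG ha
  set u : Fin N → ℚ := Pi.single ⟨a, (hN a ha).1⟩ 1 with hu
  have key : ∀ k ≤ N, (∀ c : Fin N, (u ᵥ* ((List.range k).flatMap fun _ =>
      (List.range N).map (rowMatrix N fin E)).prod) c ≠ 0 →
        c.1 = fin ∨ Level nx ap Good (N - k) c) ∧
      (u ᵥ* ((List.range k).flatMap fun _ =>
      (List.range N).map (rowMatrix N fin E)).prod) ⬝ᵥ valueVec nx ap sg N fin =
        u ⬝ᵥ valueVec nx ap sg N fin := by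
    intro k
    induction k with
    | zero =>
      intro _
      simp only [List.range_zero, List.flatMap_nil, List.prod_nil, vecMul_one]
      refine ⟨fun c hc => .inr ?_, trivial⟩
      have hca : c = ⟨a, (hN a ha).1⟩ := by
        by_contra e
        exact hc (by simp [hu, e])
      subst hca
      exact Level.mono (m := s + 1) ⟨ha, hsa⟩ (by omega)
    | succ k ih =>
      intro hk
      obtain ⟨i1, i2⟩ := ih (by omega)
      rw [List.range_succ, List.flatMap_append, List.prod_append, List.flatMap_singleton,
        ← vecMul_vecMul]
      rw [show N - k = N - (k + 1) + 1 by omega] at i1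
      obtain ⟨h1, h2⟩ := vecMul_round hN hfin hG hE (by omega : N - (k + 1) ≤ N) i1
      exact ⟨h1, h2.trans i2⟩
  obtain ⟨h1, h2⟩ := key N le_rfl
  rw [Nat.sub_self] at h1
  change (∀ c, (u ᵥ* (matrices N fin E).prod) c ≠ 0 → _) at h1
  change (u ᵥ* (matrices N fin E).prod) ⬝ᵥ _ = _ at h2
  have e1 : (u ᵥ* (matrices N fin E).prod) ⬝ᵥ valueVec nx ap sg N fin =
      (u ᵥ* (matrices N fin E).prod) ⟨fin, hfin⟩ := by
    rw [dotProduct, Finset.sum_eq_single (⟨fin, hfin⟩ : Fin N)]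
    · simp [valueVec]
    · intro c _ hc
      have : (u ᵥ* (matrices N fin E).prod) c = 0 := by
        by_contra h
        rcases h1 c h with h | h
        · exact hc (Fin.ext h)
        · exact h
      rw [this, zero_mul]
    · simp
  rw [e1] at h2
  simp only [hu, single_one_vecMul, single_one_dotProduct] at h2
  rw [show value nx ap sg t a = value nx ap sg N a from ?_]
  · simpa [valueVec, (hN a ha).2] using h2
  · rcases le_total t N with h | h
    · exact (ht.value_eq h).symm
    · exact (hsa.mono hs.le).value_eq h

end Product

/-! ### Treewidth -/

/-- A matrix whose entries off the diagonal all lie in one row has treewidth at most one: the bags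
are the pairs that consist of this index and another one. -/
theorem treewidthLE_rowMatrix {N a : ℕ} (ha : a < N) (fin : ℕ) (E : ℕ → ℕ → ℕ) :
    TreewidthLE (supportGraph (rowMatrix N fin E a)) 1 := by
  have : Nonempty (Fin N) := ⟨⟨a, ha⟩⟩
  obtain ⟨T, -, hT⟩ := (SimpleGraph.connected_top (V := Fin N)).exists_isTree_le
  refine ⟨Fin N, inferInstance, ⟨T, hT, fun v => {⟨a, ha⟩, v}, fun v => ⟨v, by simp⟩, ?_, ?_⟩,
    fun v => Finset.card_le_two⟩
  · intro u v huv
    simp only [supportGraph, SimpleGraph.fromRel_adj] at huv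
    obtain ⟨hne, h⟩ := huv
    have key : ∀ u v : Fin N, u ≠ v → rowMatrix N fin E a u v ≠ 0 → u = ⟨a, ha⟩ := by
      intro u v hne h
      by_contra hu
      rw [rowMatrix_of_ne (.inl fun e => hu (Fin.ext e)), if_neg hne] at h
      exact h rfl
    rcases h with h | h
    · exact ⟨v, by simp [key u v hne h], by simp⟩
    · exact ⟨u, by simp, by simp [key v u hne.symm h]⟩
  · intro v s t hs ht p hp r hr
    simp only [Finset.mem_insert, Finset.mem_singleton] at hs ht ⊢
    by_cases hv : v = ⟨a, ha⟩
    · exact .inl hv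
    · obtain rfl : v = s := by tauto
      obtain rfl : v = t := by tauto
      rw [(SimpleGraph.Walk.isPath_iff_nil.1 hp).eq_nil, SimpleGraph.Walk.support_nil,
        List.mem_singleton] at hr
      exact .inr hr.symm

end Branching

/-! ### Configurations as numbers -/

namespace CfgCode

/-- The number with base-`b` digits `d 0, …, d (n - 1)`, least significant digit first. -/
def pack (b n : ℕ) (d : ℕ → ℕ) : ℕ := ∑ j ∈ Finset.range n, d j * b ^ j

/-- The base-`b` digit of weight `b ^ j`. -/
def digit (b a j : ℕ) : ℕ := a / b ^ j % b

theorem pack_succ (b n : ℕ) (d : ℕ → ℕ) :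
    pack b (n + 1) d = d 0 + b * pack b n fun j => d (j + 1) := by
  rw [pack, Finset.sum_range_succ', pack, Finset.mul_sum, add_comm]
  congr 1
  · simp
  · exact Finset.sum_congr rfl fun j _ => by ring

theorem pack_lt {b n : ℕ} {d : ℕ → ℕ} (hd : ∀ j < n, d j < b) : pack b n d < b ^ n := by
  induction n generalizing d with
  | zero => simp [pack]
  | succ n ih =>
    have h1 := ih (d := fun j => d (j + 1)) fun j hj => hd (j + 1) (by omega)
    have h0 := hd 0 (by omega)
    rw [pack_succ, pow_succ']
    calc d 0 + b * pack b n (fun j => d (j + 1))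
        < b * (pack b n (fun j => d (j + 1)) + 1) := by rw [mul_add]; omega
      _ ≤ b * b ^ n := Nat.mul_le_mul_left b h1

theorem digit_pack {b n : ℕ} {d : ℕ → ℕ} (hd : ∀ j < n, d j < b) {j : ℕ} (hj : j < n) :
    digit b (pack b n d) j = d j := by
  induction n generalizing d j with
  | zero => omega
  | succ n ih =>
    have h0 := hd 0 (by omega)
    rw [pack_succ]
    cases j with
    | zero => rw [digit, pow_zero, Nat.div_one, Nat.add_mul_mod_self_left, Nat.mod_eq_of_lt h0]
    | succ j =>
      rw [digit, pow_succ', ← Nat.div_div_eq_div_mul, Nat.add_mul_div_left _ _ (by omega),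
        Nat.div_eq_of_lt h0, zero_add]
      exact ih (d := fun j => d (j + 1)) (fun j hj => hd (j + 1) (by omega)) (by omega)

theorem exists_numbering {α : Type} [Finite α] (a₀ : α) :
    ∃ (n : ℕ) (f : α → ℕ), Function.Injective f ∧ f a₀ = 0 ∧ ∀ a, f a < n := by
  obtain ⟨n, ⟨e⟩⟩ := Finite.exists_equiv_fin α
  have : NeZero n := ⟨by rintro rfl; exact (e a₀).elim0⟩
  exact ⟨n, fun a => (Equiv.swap (e a₀) 0 (e a)).1,
    fun a b h => e.injective ((Equiv.swap (e a₀) 0).injective (Fin.ext h)),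
    by simp, fun a => (Equiv.swap (e a₀) 0 (e a)).2⟩

/-! ### A work tape as a pair of numbers -/

section Tape

variable {Γ : Type} (g : ℕ) (c : Γ → ℕ)

/-- The cells to the left of the head as a number in bijective base `g` (with digits `1, …, g`), so
that the number is zero if and only if the head is on the cell `0`. -/
def left (t : ℕ → Γ) : ℕ → ℕ
  | 0 => 0
  | h + 1 => left t h * g + (c (t h) + 1)

/-- `r` describes the cells from the position `h` on, as a number in base `g` that starts with the
least significant digit; a blank is the digit zero. -/
def IsRight (t : ℕ → Γ) (h r : ℕ) : Prop := ∀ j, r / g ^ j % g = c (t (h + j))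

/-- The number of the cells to the left of the head after writing the symbol `w` and moving. -/
def newLeft (d : Dir) (w l : ℕ) : ℕ :=
  match d with
  | .left => (l - 1) / g
  | .stay => l
  | .right => l * g + (w + 1)

/-- The number of the remaining cells after writing the symbol `w` and moving. -/
def newRight (d : Dir) (w l r : ℕ) : ℕ :=
  match d with
  | .left => if l = 0 then r / g * g + w else (r / g * g + w) * g + (l - 1) % g
  | .stay => r / g * g + w
  | .right => r / g

variable {g c}

theorem isRight_iff {t : ℕ → Γ} {h r : ℕ} :
    IsRight g c t h r ↔ r % g = c (t h) ∧ IsRight g c t (h + 1) (r / g) := by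
  constructor
  · intro H
    refine ⟨by simpa using H 0, fun j => ?_⟩
    rw [Nat.div_div_eq_div_mul, ← pow_succ', H (j + 1)]
    congr 2
    omega
  · rintro ⟨h0, H⟩ j
    cases j with
    | zero => simpa using h0
    | succ j =>
      rw [pow_succ', ← Nat.div_div_eq_div_mul, H j]
      congr 2
      omega

theorem IsRight.congr {t t' : ℕ → Γ} {h r : ℕ} (H : IsRight g c t h r)
    (e : ∀ j, h ≤ j → t' j = t j) : IsRight g c t' h r := fun j => by
  rw [H j, e _ (by omega)]

theorem left_congr {t t' : ℕ → Γ} {h : ℕ} (e : ∀ j < h, t' j = t j) :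
    left g c t' h = left g c t h := by
  induction h with
  | zero => rfl
  | succ h ih => rw [left, left, ih fun j hj => e j (by omega), e h (by omega)]

theorem left_lt (hc : ∀ a, c a < g) (t : ℕ → Γ) (h : ℕ) : left g c t h < (g + 1) ^ h := by
  induction h with
  | zero => simp [left]
  | succ h ih =>
    have := hc (t h)
    rw [left, pow_succ]
    nlinarith

theorem left_update (t : ℕ → Γ) (h : ℕ) (γ : Γ) :
    left g c (Function.update t h γ) h = left g c t h :=
  left_congr fun _ hj => Function.update_of_ne hj.ne _ _

theorem newLeft_eq (hc : ∀ a, c a < g) (t : ℕ → Γ) (h : ℕ) (γ : Γ) (d : Dir) :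
    newLeft g d (c γ) (left g c t h) = left g c (Function.update t h γ) (d.move h) := by
  cases d with
  | stay => exact (left_update t h γ).symm
  | right => simp [newLeft, Dir.move, left, left_update]
  | left =>
    cases h with
    | zero => simp [newLeft, Dir.move, left]
    | succ h =>
      have hg := hc (t h)
      have e : left g c (Function.update t (h + 1) γ) h = left g c t h :=
        left_congr fun _ hj => Function.update_of_ne (by omega) _ _
      simp only [newLeft, Dir.move, Nat.add_sub_cancel, e]
      rw [left, ← add_assoc, Nat.add_sub_cancel, mul_comm, Nat.mul_add_div (by omega),
        Nat.div_eq_of_lt hg, add_zero]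

theorem isRight_newRight (hc : ∀ a, c a < g) {t : ℕ → Γ} {h r : ℕ} (H : IsRight g c t h r) (γ : Γ)
    (d : Dir) :
    IsRight g c (Function.update t h γ) (d.move h) (newRight g d (c γ) (left g c t h) r) := by
  have hγ := hc γ
  have H1 : IsRight g c (Function.update t h γ) (h + 1) (r / g) :=
    (isRight_iff.1 H).2.congr fun j hj => Function.update_of_ne (by omega) _ _
  have H0 : IsRight g c (Function.update t h γ) h (r / g * g + c γ) := by
    refine isRight_iff.2 ⟨?_, ?_⟩
    · rw [Nat.mul_add_mod_self_right, Nat.mod_eq_of_lt hγ, Function.update_self]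
    · rw [mul_comm, Nat.mul_add_div (by omega), Nat.div_eq_of_lt hγ, add_zero]
      exact H1
  cases d with
  | stay => exact H0
  | right => exact H1
  | left =>
    cases h with
    | zero => simpa [newRight, left, Dir.move] using H0
    | succ h =>
      have hg := hc (t h)
      have hl : left g c t (h + 1) ≠ 0 := by simp [left]
      simp only [newRight, hl, if_false, Dir.move, Nat.add_sub_cancel]
      refine isRight_iff.2 ⟨?_, ?_⟩
      · rw [Nat.mul_add_mod_self_right, Nat.mod_mod, left, ← add_assoc, Nat.add_sub_cancel,
          Nat.mul_add_mod_self_right, Nat.mod_eq_of_lt hg, Function.update_of_ne (by omega)]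
      · rw [mul_comm, Nat.mul_add_div (by omega),
          Nat.div_eq_of_lt (Nat.mod_lt _ (by omega)), add_zero]
        exact H0

theorem newRight_lt (hg : 0 < g) {S h r w l : ℕ} (hw : w < g) (hr : r < g ^ (S + 1 - h))
    (hl : l = 0 ↔ h = 0) (hh : h ≤ S) (d : Dir) :
    newRight g d w l r < g ^ (S + 1 - d.move h) := by
  have e : S + 1 - h = (S - h) + 1 := by omega
  have hr' : r / g < g ^ (S - h) := by
    rw [e, pow_succ] at hr
    exact Nat.div_lt_of_lt_mul (by rwa [mul_comm] at hr)
  have step : ∀ {a n b : ℕ}, a < g ^ n → b < g → a * g + b < g ^ (n + 1) := by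
    intro a n b ha hb
    rw [pow_succ]
    nlinarith
  cases d with
  | stay => rw [show S + 1 - Dir.stay.move h = (S - h) + 1 from e]; exact step hr' hw
  | right =>
    rw [show S + 1 - Dir.right.move h = S - h by simp only [Dir.move]; omega]
    exact hr'
  | left =>
    simp only [newRight]
    split_ifs with h0
    · obtain rfl := hl.1 h0
      exact step hr' hw
    · have : h ≠ 0 := fun e => h0 (hl.2 e)
      rw [show S + 1 - Dir.left.move h = (S - h) + 1 + 1 by simp only [Dir.move]; omega]
      exact step (step hr' hw) (Nat.mod_lt _ hg)

theorem left_eq_zero_iff {t : ℕ → Γ} {h : ℕ} : left g c t h = 0 ↔ h = 0 := by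
  cases h <;> simp [left]

end Tape

end CfgCode

/-! ### Simulation of a nondeterministic machine on numbers -/

namespace CfgCode

variable {M : NTM Bool}

/-- Numberings of the states and of the tape symbols of a machine in which the initial state and
the blank have the number zero. -/
structure Numbering (M : NTM Bool) where
  nQ : ℕ
  cQ : M.Q → ℕ
  cQ_injective : Function.Injective cQ
  cQ_start : cQ M.start = 0
  cQ_lt : ∀ q, cQ q < nQ
  g : ℕ
  cΓ : M.Γ → ℕ
  cΓ_injective : Function.Injective cΓ
  cΓ_blank : cΓ M.blank = 0
  cΓ_lt : ∀ γ, cΓ γ < g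

theorem nonempty_numbering (M : NTM Bool) : Nonempty (Numbering M) := by
  have := M.finQ
  have := M.finΓ
  obtain ⟨n, f, h1, h2, h3⟩ := exists_numbering M.start
  obtain ⟨n', f', h1', h2', h3'⟩ := exists_numbering M.blank
  exact ⟨⟨n, f, h1, h2, h3, n', f', h1', h2', h3'⟩⟩

/-- The symbol of `x` that corresponds to a symbol of the pair `(x, 1ᵏ)`: the second component looks
like the right end marker. -/
def toInSym : InSym (Option Bool) → InSym Bool
  | .leftEnd => .leftEnd
  | .sym (some a) => .sym a
  | .sym none => .rightEnd
  | .rightEnd => .rightEnd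

theorem toInSym_readInput (x : List Bool) (k p : ℕ) :
    toInSym (readInput (pairWord x k) p) = readInput x p := by
  cases p with
  | zero => rfl
  | succ p =>
    simp only [readInput, pairWord]
    by_cases hp : p < x.length
    · rw [List.getElem?_append_left (by simpa using hp)]
      simp [List.getElem?_eq_getElem hp, toInSym]
    · rw [List.getElem?_append_right (by simpa using hp), List.getElem?_eq_none (not_lt.1 hp)]
      rw [List.getElem?_replicate]
      split_ifs <;> rfl

/-- What determines the possible transitions: the state, the input symbol and the scanned tape
symbols. -/
abbrev Key (M : NTM Bool) : Type := M.Q × InSym Bool × (Fin M.k → M.Γ)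

instance : Finite (InSym Bool) :=
  Finite.of_injective
    (fun s : InSym Bool => match s with
      | .leftEnd => (none : Option (Option Bool))
      | .sym a => some (some a)
      | .rightEnd => some none)
    (by rintro (_ | _ | _) (_ | _ | _) <;> simp)

noncomputable instance (M : NTM Bool) : Fintype (Key M) := by
  have := M.finQ
  have := M.finΓ
  exact Fintype.ofFinite _

/-- The transitions for a key. -/
def Key.next (κ : Key M) : Finset (Transition M.Q M.Γ M.k) := M.δ κ.1 κ.2.1 κ.2.2

section Numbers

variable (D : Numbering M) (b : ℕ) (y : List (Option Bool))

/-- The position of the input head after a transition that reads the input symbol `s`. -/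
def newPos (s : InSym Bool) (d : Dir) (p : ℕ) : ℕ :=
  match d, s with
  | .left, _ => p - 1
  | .stay, _ => p
  | .right, .rightEnd => p
  | .right, _ => p + 1

/-- A configuration is coded by its base-`b` digits: the state, the position of the input head, and
for each work tape the numbers of its left and its right part. This is the digit `j` of the
configuration reached from `a` by the transition `t`. -/
def newDigit (s : InSym Bool) (t : Transition M.Q M.Γ M.k) (a : ℕ) : ℕ → ℕ
  | 0 => D.cQ t.state
  | 1 => newPos s t.inDir (digit b a 1)
  | j + 2 => if h : j / 2 < M.k then
      if j % 2 = 0 then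
        newLeft D.g (t.dir ⟨j / 2, h⟩) (D.cΓ (t.write ⟨j / 2, h⟩)) (digit b a (2 * (j / 2) + 2))
      else newRight D.g (t.dir ⟨j / 2, h⟩) (D.cΓ (t.write ⟨j / 2, h⟩))
        (digit b a (2 * (j / 2) + 2)) (digit b a (2 * (j / 2) + 3))
    else 0

/-- The code of the configuration reached from `a` by the transition `t`. -/
def succCode (s : InSym Bool) (t : Transition M.Q M.Γ M.k) (a : ℕ) : ℕ :=
  pack b (2 * M.k + 2) (newDigit D b s t a)

/-- The input symbol scanned in the configuration with the code `a`. -/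
def scanCode (a : ℕ) : InSym Bool := toInSym (readInput y (digit b a 1))

/-- The configuration with the code `a` has the key `κ`. -/
def Matches (κ : Key M) (a : ℕ) : Prop :=
  D.cQ κ.1 = digit b a 0 ∧ scanCode b y a = κ.2.1 ∧
    ∀ i : Fin M.k, digit b a (2 * i + 3) % D.g = D.cΓ (κ.2.2 i)

open Classical in
/-- The entries of the row `a` of the matrix for the key `κ`, shifted by one; the index `D.nQ` codes
no configuration, and collects the results. -/
noncomputable def keyWeight (κ : Key M) (a c : ℕ) : ℕ :=
  if κ.next = ∅ then
    if M.accept κ.1 then (if c = D.nQ then 2 else 1) else (if c = D.nQ then 0 else 1)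
  else 1 + ∑ t ∈ κ.next, if succCode D b κ.2.1 t a = c then 1 else 0

open Classical in
/-- The entries of the row `a`, shifted by one. -/
noncomputable def weight (a c : ℕ) : ℕ :=
  ∑ κ : Key M, if Matches D b y κ a then keyWeight D b κ a c else 0

open Classical in
/-- The keys of the configuration with the code `a`. -/
noncomputable def keys (a : ℕ) : Finset (Key M) := Finset.univ.filter fun κ => Matches D b y κ a

open Classical in
/-- The transitions that are possible in the configuration with the code `a`. -/
noncomputable def nextCode (a : ℕ) : Finset (Transition M.Q M.Γ M.k) :=
  (keys D b y a).biUnion Key.next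

/-- The contribution of a computation path that ends in the configuration with the code `a`. -/
noncomputable def signCode (a : ℕ) : ℤ := ∑ κ ∈ keys D b y a, if M.accept κ.1 then 1 else -1

/-- The code of the configuration reached from `a` by the transition `t`. -/
def applyCode (a : ℕ) (t : Transition M.Q M.Γ M.k) : ℕ := succCode D b (scanCode b y a) t a

/-- The configuration `c` has the code `a`; here `n` is the length of the input, and the work heads
are on the cells `0, …, S`. -/
structure Codes (S n : ℕ) (c : Cfg M.Q M.Γ M.k) (a : ℕ) : Prop where
  lt : a < b ^ (2 * M.k + 2)
  state : digit b a 0 = D.cQ c.state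
  pos : digit b a 1 = c.inPos
  left : ∀ i : Fin M.k, digit b a (2 * i + 2) = left D.g D.cΓ (c.tape i) (c.head i)
  right : ∀ i : Fin M.k, IsRight D.g D.cΓ (c.tape i) (c.head i) (digit b a (2 * i + 3))
  right_lt : ∀ i : Fin M.k, digit b a (2 * i + 3) < D.g ^ (S + 1 - c.head i)
  pos_le : c.inPos ≤ n + 1
  head_le : ∀ i, c.head i ≤ S

variable {D b y} {S n : ℕ} {c : Cfg M.Q M.Γ M.k} {a : ℕ}

/-- The code of the initial configuration is `0`, as the initial state and the blank have number
`0`. -/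
theorem codes_init (hb : 0 < b) : Codes D b S n M.init 0 := by
  have h0 : ∀ j, digit b 0 j = 0 := fun j => by simp [digit]
  have hg : 0 < D.g := (Nat.zero_le _).trans_lt (D.cΓ_lt M.blank)
  refine ⟨Nat.pow_pos hb, ?_, ?_, fun i => ?_, fun i j => ?_, fun i => ?_, ?_, fun i => ?_⟩
  · rw [h0]; exact D.cQ_start.symm
  · rw [h0]; rfl
  · rw [h0]; rfl
  · rw [h0]; simpa [NTM.init] using D.cΓ_blank.symm
  · rw [h0]; exact Nat.pow_pos hg
  · simp [NTM.init]
  · simp [NTM.init]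

/-- An input head within the end markers is stopped at the right one exactly if it scans it. -/
theorem newPos_eq {x : List Bool} {p : ℕ} (hp : p ≤ x.length + 1) (d : Dir) :
    newPos (readInput x p) d p = min (d.move p) (x.length + 1) := by
  have h := RegMachine.readInput_eq_rightEnd_iff (x := x) (p := p)
  cases d with
  | left => simp only [newPos, Dir.move]; omega
  | stay => simp only [newPos, Dir.move]; omega
  | right =>
    cases hs : readInput x p with
    | rightEnd =>
      have := h.1 hs
      simp only [newPos, Dir.move]
      omega
    | _ =>
      have : ¬ x.length < p := fun hc => by rw [h.2 hc] at hs; cases hs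
      simp only [newPos, Dir.move]
      omega

/-- Transitions act on codes as they act on configurations. -/
theorem Codes.apply {x : List Bool} (h : Codes D b S x.length c a)
    (hb : (D.g + 1) ^ (S + 1) ≤ b) (hx : x.length + 1 < b) (hQ : D.nQ < b)
    (t : Transition M.Q M.Γ M.k) (hS : ∀ i, (c.apply x.length t).head i ≤ S) :
    Codes D b S x.length (c.apply x.length t) (succCode D b (readInput x c.inPos) t a) := by
  have d0 : newDigit D b (readInput x c.inPos) t a 0 = D.cQ (c.apply x.length t).state := rfl
  have d1 : newDigit D b (readInput x c.inPos) t a 1 = (c.apply x.length t).inPos := by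
    rw [newDigit, h.pos, newPos_eq h.pos_le]
    rfl
  have dl : ∀ i : Fin M.k, newDigit D b (readInput x c.inPos) t a (2 * i + 2) =
      CfgCode.left D.g D.cΓ ((c.apply x.length t).tape i) ((c.apply x.length t).head i) := by
    intro i
    have e : 2 * i.1 / 2 = i.1 := by omega
    simp only [newDigit, e, i.2, dif_pos, Nat.mul_mod_right, if_true, h.left]
    exact newLeft_eq D.cΓ_lt _ _ _ _
  have dr : ∀ i : Fin M.k, newDigit D b (readInput x c.inPos) t a (2 * i + 3) =
      newRight D.g (t.dir i) (D.cΓ (t.write i)) (CfgCode.left D.g D.cΓ (c.tape i) (c.head i))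
        (digit b a (2 * i + 3)) := by
    intro i
    have e : (2 * i.1 + 1) / 2 = i.1 := by omega
    have e' : ¬ (2 * i.1 + 1) % 2 = 0 := by omega
    simp only [newDigit, e, i.2, dif_pos, e', if_false, h.left]
  have drl : ∀ i : Fin M.k, newDigit D b (readInput x c.inPos) t a (2 * i + 3) <
      D.g ^ (S + 1 - (c.apply x.length t).head i) := by
    intro i
    rw [dr]
    exact newRight_lt ((Nat.zero_le _).trans_lt (D.cΓ_lt M.blank)) (D.cΓ_lt _) (h.right_lt i)
      left_eq_zero_iff (h.head_le i) _
  have hpow : ∀ m ≤ S + 1, (D.g + 1) ^ m ≤ b := fun m hm =>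
    (Nat.pow_le_pow_right (by omega) hm).trans hb
  have hlt : ∀ j < 2 * M.k + 2, newDigit D b (readInput x c.inPos) t a j < b := by
    intro j hj
    rcases j with _ | _ | j
    · rw [d0]; exact (D.cQ_lt _).trans hQ
    · rw [zero_add, d1]
      exact (min_le_right _ _).trans_lt hx
    · rcases Nat.even_or_odd' j with ⟨i, rfl | rfl⟩
      · have := dl ⟨i, by omega⟩
        simp only at this
        rw [show 2 * i + 1 + 1 = 2 * i + 2 from rfl, this]
        exact (left_lt D.cΓ_lt _ _).trans_le (hpow _ ((hS _).trans (Nat.le_succ S)))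
      · have := drl ⟨i, by omega⟩
        simp only at this
        refine this.trans_le ((Nat.pow_le_pow_left (Nat.le_succ _) _).trans (hpow _ ?_))
        omega
  have hd : ∀ j < 2 * M.k + 2, digit b (succCode D b (readInput x c.inPos) t a) j =
      newDigit D b (readInput x c.inPos) t a j := fun j hj => digit_pack hlt hj
  refine ⟨pack_lt hlt, ?_, ?_, fun i => ?_, fun i => ?_, fun i => ?_, min_le_right _ _, hS⟩
  · rw [hd 0 (by omega), d0]
  · rw [hd 1 (by omega), d1]
  · rw [hd _ (by omega), dl]
  · rw [hd _ (by omega), dr]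
    exact isRight_newRight D.cΓ_lt (h.right i) (t.write i) (t.dir i)
  · rw [hd _ (by omega)]
    exact drl i

/-- The key of a configuration. -/
def keyOf (x : List Bool) (c : Cfg M.Q M.Γ M.k) : Key M :=
  (c.state, readInput x c.inPos, c.scanned)

section Pair

variable {x : List Bool} {k : ℕ}

theorem Codes.scanCode (h : Codes D b S n c a) :
    scanCode b (pairWord x k) a = readInput x c.inPos := by
  rw [CfgCode.scanCode, h.pos, toInSym_readInput]

theorem Codes.matches_iff (h : Codes D b S n c a) (κ : Key M) :
    Matches D b (pairWord x k) κ a ↔ κ = keyOf x c := by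
  obtain ⟨q, s, σ⟩ := κ
  simp only [Matches, h.scanCode, h.state, D.cQ_injective.eq_iff, keyOf, Prod.mk.injEq]
  refine and_congr Iff.rfl (and_congr eq_comm ?_)
  rw [funext_iff]
  refine forall_congr' fun i => ?_
  have := h.right i 0
  rw [pow_zero, Nat.div_one, add_zero] at this
  rw [this, D.cΓ_injective.eq_iff, eq_comm]
  rfl

theorem Codes.keys (h : Codes D b S n c a) : keys D b (pairWord x k) a = {keyOf x c} := by
  ext κ
  simp [CfgCode.keys, h.matches_iff]

theorem Codes.nextCode (h : Codes D b S n c a) :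
    nextCode D b (pairWord x k) a = M.next x c := by
  ext t
  simp only [CfgCode.nextCode, h.keys, Finset.mem_biUnion, Finset.mem_singleton, exists_eq_left]
  rfl

theorem Codes.signCode (h : Codes D b S n c a) :
    signCode D b (pairWord x k) a = if M.accept c.state then 1 else -1 := by
  rw [CfgCode.signCode, h.keys, Finset.sum_singleton]
  rfl

theorem Codes.weight (h : Codes D b S n c a) (e : ℕ) :
    weight D b (pairWord x k) a e = keyWeight D b (keyOf x c) a e := by
  rw [CfgCode.weight, Finset.sum_eq_single (keyOf x c)]
  · rw [if_pos (h.matches_iff _ |>.2 rfl)]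
  · intro κ _ hκ
    rw [if_neg fun hm => hκ ((h.matches_iff κ).1 hm)]
  · simp

/-- The codes of the reachable configurations. -/
def ReachCode (D : Numbering M) (b S : ℕ) (x : List Bool) (a : ℕ) : Prop :=
  ∃ c, Relation.ReflTransGen (M.Step x) M.init c ∧ Codes D b S x.length c a

/-- The function `weight` describes the transitions between codes of reachable configurations. -/
theorem isWeight :
    Branching.IsWeight (nextCode D b (pairWord x k)) (applyCode D b (pairWord x k))
      (signCode D b (pairWord x k)) (ReachCode D b S x) D.nQ (weight D b (pairWord x k)) := by
  rintro a ⟨c, -, h⟩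
  have hn : (keyOf x c).next = M.next x c := rfl
  constructor
  · intro he e
    rw [h.nextCode] at he
    rw [h.weight, keyWeight, hn, if_pos he, h.signCode, keyOf]
    split_ifs <;> simp
  · intro he e
    rw [h.nextCode] at he ⊢
    rw [h.weight, keyWeight, hn, if_neg he]
    push_cast
    rw [add_sub_cancel_left]
    refine Finset.sum_congr rfl fun t _ => ?_
    simp only [applyCode, h.scanCode, keyOf]
    congr

section Simulation

variable (hM : ∀ c, Relation.ReflTransGen (M.Step x) M.init c → ∀ i, c.head i ≤ S)
  (hb : (D.g + 1) ^ (S + 1) ≤ b) (hx : x.length + 1 < b) (hQ : D.nQ < b)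

include hM hb hx hQ

theorem codes_step {t : Transition M.Q M.Γ M.k} (hc : Relation.ReflTransGen (M.Step x) M.init c)
    (h : Codes D b S x.length c a) (ht : t ∈ M.next x c) :
    Relation.ReflTransGen (M.Step x) M.init (c.apply x.length t) ∧
      Codes D b S x.length (c.apply x.length t) (applyCode D b (pairWord x k) a t) := by
  have h1 : Relation.ReflTransGen (M.Step x) M.init (c.apply x.length t) := hc.tail ⟨t, ht, rfl⟩
  refine ⟨h1, ?_⟩
  rw [applyCode, h.scanCode]
  exact h.apply hb hx hQ t (hM _ h1)

theorem haltsIn_code {t : ℕ} (hc : Relation.ReflTransGen (M.Step x) M.init c)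
    (h : Codes D b S x.length c a) (ht : M.HaltsIn x t c) :
    Branching.HaltsIn (nextCode D b (pairWord x k)) (applyCode D b (pairWord x k)) t a := by
  induction t generalizing c a with
  | zero => rw [Branching.HaltsIn, h.nextCode]; exact ht
  | succ t ih =>
    intro i hi
    rw [h.nextCode] at hi
    obtain ⟨h1, h2⟩ := codes_step hM hb hx hQ (k := k) hc h hi
    exact ih h1 h2 (ht i hi)

/-- The value of the code of a configuration counts the computation paths that start there. -/
theorem value_code {t : ℕ} (hc : Relation.ReflTransGen (M.Step x) M.init c)
    (h : Codes D b S x.length c a) :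
    Branching.value (nextCode D b (pairWord x k)) (applyCode D b (pairWord x k))
      (signCode D b (pairWord x k)) t a = (M.numPaths x true t c : ℤ) - M.numPaths x false t c := by
  induction t generalizing c a with
  | zero =>
    rw [Branching.value, h.nextCode, h.signCode, NTM.numPaths, NTM.numPaths]
    by_cases he : M.next x c = ∅ <;> cases ha : M.accept c.state <;> simp [he]
  | succ t ih =>
    rw [Branching.value, h.nextCode, h.signCode, NTM.numPaths, NTM.numPaths]
    by_cases he : M.next x c = ∅
    · cases ha : M.accept c.state <;> simp [he]
    · simp only [he, if_false]
      push_cast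
      rw [← Finset.sum_sub_distrib]
      refine Finset.sum_congr rfl fun i hi => ?_
      obtain ⟨h1, h2⟩ := codes_step hM hb hx hQ (k := k) hc h hi
      exact ih h1 h2

/-- The product of the matrices counts the computation paths. The index `D.nQ` is no code of a
configuration because its digit for the state is too large. -/
theorem prod_matrices_eq {t : ℕ} (ht : M.HaltsIn x t M.init)
    (h0 : 0 < b ^ (2 * M.k + 2)) (hfin : D.nQ < b ^ (2 * M.k + 2)) :
    (Branching.matrices (b ^ (2 * M.k + 2)) D.nQ (weight D b (pairWord x k))).prod
      ⟨0, h0⟩ ⟨D.nQ, hfin⟩ =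
      (((M.numPaths x true t M.init : ℤ) - M.numPaths x false t M.init : ℤ) : ℚ) := by
  have hi : Codes D b S x.length M.init 0 := codes_init (by omega)
  rw [← value_code hM hb hx hQ (k := k) .refl hi]
  refine Branching.prod_matrices_apply (Good := ReachCode D b S x) ?_ hfin ?_ isWeight
    ⟨_, .refl, hi⟩ (haltsIn_code hM hb hx hQ .refl hi ht)
  · rintro a ⟨c, -, h⟩
    refine ⟨h.lt, fun e => ?_⟩
    have h1 := h.state
    have h2 := D.cQ_lt c.state
    rw [e, digit, pow_zero, Nat.div_one, Nat.mod_eq_of_lt hQ] at h1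
    omega
  · rintro a ⟨c, hc, h⟩ i hi
    rw [h.nextCode] at hi
    exact ⟨_, codes_step hM hb hx hQ hc h hi⟩

end Simulation

end Pair

end Numbers

end CfgCode

/-! ### Computing the entries of the matrices -/

namespace CfgCode

open RegMachine

variable {B : Type} {M : NTM Bool} (D : Numbering M)
  {f f' : List (Option Bool) → (ℕ → ℕ) → ℕ} {base : List (Option Bool) → ℕ}

theorem regComputable_digit (hb : RegComputable B fun y _ => base y) (hf : RegComputable B f)
    (j : ℕ) : RegComputable B fun y v => digit (base y) (f y v) j :=
  (hf.div (hb.pow j)).mod hb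

theorem regComputable_newPos (hf : RegComputable B f) (s : InSym Bool) (d : Dir) :
    RegComputable B fun y v => newPos s d (f y v) := by
  cases d with
  | left => exact hf.sub (.const 1)
  | stay => exact hf
  | right =>
    cases s with
    | rightEnd => exact hf
    | leftEnd => exact hf.add (.const 1)
    | sym a => exact hf.add (.const 1)

theorem regComputable_newLeft (hf : RegComputable B f) (g : ℕ) (d : Dir) (w : ℕ) :
    RegComputable B fun y v => newLeft g d w (f y v) := by
  cases d with
  | left => exact (hf.sub (.const 1)).div (.const g)
  | stay => exact hf
  | right => exact (hf.mul (.const g)).add (.const (w + 1))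

theorem regComputable_newRight (hf : RegComputable B f) (hf' : RegComputable B f') (g : ℕ) (d : Dir)
    (w : ℕ) : RegComputable B fun y v => newRight g d w (f y v) (f' y v) := by
  have h := ((hf'.div (.const g)).mul (.const g)).add (.const w)
  cases d with
  | left =>
    exact .ite (.eq hf (.const 0)) h ((h.mul (.const g)).add ((hf.sub (.const 1)).mod (.const g)))
  | stay => exact h
  | right => exact hf'.div (.const g)

theorem regComputable_newDigit (hb : RegComputable B fun y _ => base y) (hf : RegComputable B f)
    (s : InSym Bool) (t : Transition M.Q M.Γ M.k) (j : ℕ) :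
    RegComputable B fun y v => newDigit D (base y) s t (f y v) j := by
  rcases j with _ | _ | j
  · exact .const _
  · exact regComputable_newPos (regComputable_digit hb hf 1) s t.inDir
  · simp only [newDigit]
    split_ifs with h
    · exact regComputable_newLeft (regComputable_digit hb hf _) _ _ _
    · exact regComputable_newRight (regComputable_digit hb hf _) (regComputable_digit hb hf _) _ _ _
    · exact .const 0

theorem regComputable_succCode (hb : RegComputable B fun y _ => base y) (hf : RegComputable B f)
    (s : InSym Bool) (t : Transition M.Q M.Γ M.k) :
    RegComputable B fun y v => succCode D (base y) s t (f y v) :=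
  .finset_sum (Finset.range _) fun j => (regComputable_newDigit D hb hf s t j).mul (hb.pow j)

theorem regPred_matches (hb : RegComputable B fun y _ => base y) (hf : RegComputable B f)
    (κ : Key M) : RegPred B fun y v => Matches D (base y) y κ (f y v) := by
  refine (((RegPred.eq (.const (D.cQ κ.1)) (regComputable_digit hb hf 0)).and
    ((RegPred.inp (regComputable_digit hb hf 1) fun a => toInSym a = κ.2.1).and
    (RegPred.forall_mem Finset.univ fun i : Fin M.k =>
      RegPred.eq ((regComputable_digit hb hf (2 * i + 3)).mod (.const D.g))
        (.const (D.cΓ (κ.2.2 i))))))).congr fun y v => ?_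
  simp [Matches, scanCode]

theorem regComputable_keyWeight (hb : RegComputable B fun y _ => base y) (hf : RegComputable B f)
    (hf' : RegComputable B f') (κ : Key M) :
    RegComputable B fun y v => keyWeight D (base y) κ (f y v) (f' y v) := by
  unfold keyWeight
  split_ifs
  · exact .ite (.eq hf' (.const _)) (.const 2) (.const 1)
  · exact .ite (.eq hf' (.const _)) (.const 0) (.const 1)
  · exact .add (.const 1) (.finset_sum _ fun t =>
      .ite (.eq (regComputable_succCode D hb hf κ.2.1 t) hf') (.const 1) (.const 0))

open Classical in
theorem regComputable_weight (hb : RegComputable B fun y _ => base y) (hf : RegComputable B f)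
    (hf' : RegComputable B f') :
    RegComputable B fun y v => weight D (base y) y (f y v) (f' y v) :=
  .finset_sum _ fun κ =>
    .ite (regPred_matches D hb hf κ) (regComputable_keyWeight D hb hf hf' κ) (.const 0)

/-- The entries are bounded by a constant that depends only on the machine, so that they can be printed
from a finite table. -/
theorem exists_weight_lt : ∃ m, ∀ b y a c, weight D b y a c < m := by
  refine ⟨∑ κ : Key M, (2 + κ.next.card) + 1, fun b y a c => Nat.lt_succ_of_le ?_⟩
  refine Finset.sum_le_sum fun κ _ => ?_
  have h : keyWeight D b κ a c ≤ 2 + κ.next.card := by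
    unfold keyWeight
    split_ifs <;> try omega
    have : (∑ t ∈ κ.next, if succCode D b κ.2.1 t a = c then 1 else 0) ≤ κ.next.card := by
      rw [Finset.card_eq_sum_ones]
      exact Finset.sum_le_sum fun t _ => by split_ifs <;> simp
    omega
  split_ifs
  · exact h
  · exact Nat.zero_le _

end CfgCode

/-! ### The word that encodes the matrices -/

namespace RegMachine

variable {A B : Type} {f : List A → (ℕ → ℕ) → ℕ}

/-- Printing a function of a bounded number. -/
theorem RegOutput.of_lt (hf : RegComputable B f) (h : ℕ → List B) {m : ℕ}
    (hm : ∀ x v, f x v < m) : RegOutput fun x v => h (f x v) := by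
  have key : ∀ m, RegOutput fun x v => if f x v < m then h (f x v) else [] := by
    intro m
    induction m with
    | zero => exact RegOutput.nil
    | succ m ih =>
      refine (ih.append (.ite (.eq hf (.const m)) (.const (h m)) .nil)).congr fun x v => ?_
      rcases lt_trichotomy (f x v) m with hlt | heq | hgt
      · simp [hlt, hlt.ne, hlt.trans (Nat.lt_succ_self m)]
      · simp [heq]
      · simp [hgt.ne', not_lt.2 hgt.le, show ¬ f x v < m + 1 by omega]
  exact (key m).congr fun x v => by rw [if_pos (hm x v)]

theorem flatMap_const_eq_replicate {α : Type} (n : ℕ) (a : α) :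
    ((List.range n).flatMap fun _ => [a]) = List.replicate n a := by
  induction n with
  | zero => rfl
  | succ n ih => rw [List.range_succ, List.flatMap_append, ih, List.replicate_succ']; rfl

theorem regOutput_encUnary (hf : RegComputable IMMSym f) :
    RegOutput fun x v => encUnary (f x v) :=
  ((RegOutput.flatMap hf (.single .one)).append (.single .semicolon)).congr fun x v => by
    rw [flatMap_const_eq_replicate]; rfl

end RegMachine

theorem List.flatten_ofFn_val {α : Type} (n : ℕ) (F : ℕ → List α) :
    (List.ofFn fun i : Fin n => F i).flatten = (List.range n).flatMap F := by
  rw [List.flatMap_def]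
  congr 1
  exact List.ext_getElem (by simp) fun i h h' => by simp

namespace CfgCode

open RegMachine

open Classical in
/-- The number of symbols `none`; for `pairWord x k` this is `k`. -/
noncomputable def numNone (y : List (Option Bool)) : ℕ :=
  ∑ i ∈ Finset.range y.length, if readInput y (i + 1) = .sym none then 1 else 0

theorem numNone_pairWord (x : List Bool) (k : ℕ) : numNone (pairWord x k) = k := by
  classical
  have hl : (pairWord x k).length = x.length + k := by simp [pairWord]
  rw [numNone, hl, Finset.sum_range_add]
  have h1 : ∀ i ∈ Finset.range x.length,
      (if readInput (pairWord x k) (i + 1) = .sym none then 1 else 0) = 0 := by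
    intro i hi
    have hi := Finset.mem_range.1 hi
    have : readInput (pairWord x k) (i + 1) = .sym (some x[i]) := by
      simp only [readInput, pairWord]
      rw [List.getElem?_append_left (by simpa using hi)]
      simp [List.getElem?_eq_getElem hi]
    rw [if_neg (by rw [this]; simp)]
  have h2 : ∀ i ∈ Finset.range k,
      (if readInput (pairWord x k) (x.length + i + 1) = .sym none then 1 else 0) = 1 := by
    intro i hi
    have hi := Finset.mem_range.1 hi
    have : readInput (pairWord x k) (x.length + i + 1) = .sym none := by
      simp only [readInput, pairWord]
      rw [List.getElem?_append_right (by simp), List.getElem?_replicate]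
      simp [hi]
    rw [if_pos this]
  rw [Finset.sum_congr rfl h1, Finset.sum_congr rfl h2]
  simp

variable {M : NTM Bool} (D : Numbering M) (e : ℕ) (y : List (Option Bool))

/-- The base of the codes of configurations. The exponent `e` depends only on the machine and is large
enough for all the digits. -/
def base : ℕ := (y.length + 2) ^ e

/-- The dimension of the matrices. -/
def dim (M : NTM Bool) : ℕ := base e y ^ (2 * M.k + 2)

theorem dim_pos : 0 < dim e y M := Nat.pow_pos (Nat.pow_pos (by omega))

/-- The instance of the matrix multiplication problem to which `y` is reduced. -/
noncomputable def reduction (hQ : D.nQ < dim e y M) : IMMInput where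
  d := dim e y M
  mats := Branching.matrices (dim e y M) D.nQ (weight D (base e y) y)
  i := ⟨0, dim_pos e y⟩
  j := ⟨D.nQ, hQ⟩
  k := 2 * numNone y - 1

open Classical in
/-- The entry at `(r, c)` of the matrix `a`, shifted by one. -/
noncomputable def entry (a r c : ℕ) : ℕ :=
  if r = a ∧ a ≠ D.nQ then weight D (base e y) y a c else if r = c then 2 else 1

/-- The encoding of this instance. -/
noncomputable def instanceWord : List IMMSym :=
  encUnary (dim e y M) ++
    ((List.range (dim e y M)).flatMap fun _ => (List.range (dim e y M)).flatMap fun a =>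
      [IMMSym.bar] ++ (List.range (dim e y M)).flatMap fun r =>
        ((List.range (dim e y M)).flatMap fun c => encRat ((entry D e y a r c : ℚ) - 1)) ++
          [IMMSym.semicolon]) ++
    encUnary 1 ++ encUnary (D.nQ + 1) ++ encUnary (2 * numNone y - 1)

theorem encMat_rowMatrix (a : ℕ) :
    encMat (Branching.rowMatrix (dim e y M) D.nQ (weight D (base e y) y) a) =
      [IMMSym.bar] ++ (List.range (dim e y M)).flatMap fun r =>
        ((List.range (dim e y M)).flatMap fun c => encRat ((entry D e y a r c : ℚ) - 1)) ++
          [IMMSym.semicolon] := by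
  rw [← List.flatten_ofFn_val]
  simp only [← List.flatten_ofFn_val]
  rfl

theorem encode_instance (hQ : D.nQ < dim e y M) :
    (reduction D e y hQ).encode = instanceWord D e y := by
  simp only [IMMInput.encode, reduction, instanceWord, Branching.matrices]
  congr 4
  rw [← List.flatMap_def, List.flatMap_assoc]
  simp only [List.flatMap_map, encMat_rowMatrix]

theorem regComputable_base : RegComputable IMMSym fun (y : List (Option Bool)) _ => base e y :=
  (RegComputable.length.add (.const 2)).pow e

theorem regComputable_dim (M : NTM Bool) :
    RegComputable IMMSym fun (y : List (Option Bool)) _ => dim e y M :=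
  (regComputable_base e).pow _

theorem logspaceComputable_instanceWord : LogspaceComputable fun y => instanceWord D e y := by
  classical
  have hN := regComputable_dim e M
  obtain ⟨m, hm⟩ := exists_weight_lt D
  -- The loop variables are, from the innermost to the outermost, the column, the row, the index of
  -- the matrix within a round, and the round.
  have hentry : RegComputable IMMSym fun (y : List (Option Bool)) v =>
      entry D e y (v 2) (v 1) (v 0) :=
    .ite ((RegPred.eq (.var 1) (.var 2)).and (RegPred.eq (.var 2) (.const D.nQ)).not)
      (regComputable_weight D (regComputable_base e) (.var 2) (.var 0))
      (.ite (.eq (.var 1) (.var 0)) (.const 2) (.const 1))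
  have hlt : ∀ (y : List (Option Bool)) (v : ℕ → ℕ), entry D e y (v 2) (v 1) (v 0) < m + 3 := by
    intro y v
    have := hm (base e y) y (v 2) (v 0)
    unfold entry
    split_ifs <;> omega
  have hnone : RegComputable IMMSym fun (y : List (Option Bool)) _ => numNone y :=
    .sum .length (.ite (.inp ((RegComputable.var 0).add (.const 1)) fun a => a = .sym none)
      (.const 1) (.const 0))
  have hentries : RegOutput fun (y : List (Option Bool)) v =>
      (List.range (dim e y M)).flatMap fun c => encRat ((entry D e y (v 1) (v 0) c : ℚ) - 1) :=
    .flatMap hN (.of_lt hentry (fun n => encRat ((n : ℚ) - 1)) hlt)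
  have hrow : RegOutput fun (y : List (Option Bool)) v =>
      ((List.range (dim e y M)).flatMap fun c => encRat ((entry D e y (v 1) (v 0) c : ℚ) - 1)) ++
        [IMMSym.semicolon] := hentries.append (.single IMMSym.semicolon)
  have hmat : RegOutput fun (y : List (Option Bool)) v =>
      [IMMSym.bar] ++ (List.range (dim e y M)).flatMap fun r =>
        ((List.range (dim e y M)).flatMap fun c => encRat ((entry D e y (v 0) r c : ℚ) - 1)) ++
          [IMMSym.semicolon] := (RegOutput.single IMMSym.bar).append (.flatMap hN hrow)
  have hround : RegOutput fun (y : List (Option Bool)) _ =>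
      (List.range (dim e y M)).flatMap fun a =>
        [IMMSym.bar] ++ (List.range (dim e y M)).flatMap fun r =>
          ((List.range (dim e y M)).flatMap fun c => encRat ((entry D e y a r c : ℚ) - 1)) ++
            [IMMSym.semicolon] := .flatMap hN hmat
  have hmats : RegOutput fun (y : List (Option Bool)) _ =>
      (List.range (dim e y M)).flatMap fun _ => (List.range (dim e y M)).flatMap fun a =>
        [IMMSym.bar] ++ (List.range (dim e y M)).flatMap fun r =>
          ((List.range (dim e y M)).flatMap fun c => encRat ((entry D e y a r c : ℚ) - 1)) ++
            [IMMSym.semicolon] := .flatMap hN hround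
  have ho : RegOutput fun (y : List (Option Bool)) _ => instanceWord D e y :=
    ((((regOutput_encUnary hN).append hmats).append (regOutput_encUnary (.const 1))).append
      (regOutput_encUnary (.const (D.nQ + 1)))).append
      (regOutput_encUnary (((RegComputable.const 2).mul hnone).sub (.const 1)))
  exact ho.logspaceComputable

end CfgCode

/-! ### Bits of integers -/

/-- The bit of weight `2 ^ p` of an integer is the bit number `2 p + 1` of this integer as a rational
number. Truncated subtraction makes the formula `2 * k - 1` right for the sign `k = 0` as well. -/
theorem ratBit_intCast (z : ℤ) (k : ℕ) : ratBit (z : ℚ) (2 * k - 1) = intBit z k := by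
  cases k with
  | zero => simp [ratBit, intBit]
  | succ p =>
    rw [show 2 * (p + 1) - 1 = 2 * p + 1 by omega]
    simp only [ratBit, intBit, Nat.mul_mod_right, if_true, ratDigit]
    rw [Nat.mul_div_cancel_left p (by norm_num), Nat.testBit_eq_decide_div_mod_eq,
      show |(z : ℚ)| = ((z.natAbs : ℕ) : ℚ) by rw [Nat.cast_natAbs]; simp,
      show ((2 : ℚ) ^ (p : ℤ)) = ((2 ^ p : ℕ) : ℚ) by simp]
    have : ⌊((z.natAbs : ℕ) : ℚ) / ((2 ^ p : ℕ) : ℚ)⌋ = ((z.natAbs / 2 ^ p : ℕ) : ℤ) := by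
      exact_mod_cast Rat.floor_natCast_div_natCast z.natAbs (2 ^ p)
    rw [this]
    simp only [Int.odd_coe_nat, Nat.odd_iff]

namespace CfgCode

/-- The numbers that describe work tapes of logarithmic length are digits in the base used for the
codes. -/
theorem pow_le_base (g C e : ℕ) (x : List Bool) (k : ℕ) (he : g * C + g * (C + 1) ≤ e) :
    (g + 1) ^ (C * Nat.log 2 x.length + C + 1) ≤ base e (pairWord x k) := by
  have hl : (pairWord x k).length = x.length + k := by simp [pairWord]
  set m := (pairWord x k).length + 2 with hm
  have h1 : 2 ^ Nat.log 2 x.length ≤ m := by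
    by_cases h0 : x.length = 0
    · rw [h0]; simp; omega
    · have := Nat.pow_log_le_self 2 h0
      omega
  have h2 : g + 1 ≤ 2 ^ g := Nat.lt_two_pow_self
  calc (g + 1) ^ (C * Nat.log 2 x.length + C + 1)
      ≤ (2 ^ g) ^ (C * Nat.log 2 x.length + C + 1) := Nat.pow_le_pow_left h2 _
    _ = (2 ^ Nat.log 2 x.length) ^ (g * C) * 2 ^ (g * (C + 1)) := by
        rw [← pow_mul, ← pow_mul, ← pow_add]; ring_nf
    _ ≤ m ^ (g * C) * m ^ (g * (C + 1)) :=
        Nat.mul_le_mul (Nat.pow_le_pow_left h1 _) (Nat.pow_le_pow_left (by omega) _)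
    _ = m ^ (g * C + g * (C + 1)) := (pow_add _ _ _).symm
    _ ≤ m ^ e := Nat.pow_le_pow_right (by omega) he

end CfgCode

open CfgCode in
/-- For some constant `w`, iterated multiplication of rational matrices of treewidth at most `w` is
`GapL`-hard. -/
theorem mainTheorem10 : ∃ w : ℕ, GapLHard (immBit w) := by
  refine ⟨1, fun f hf => ?_⟩
  obtain ⟨M, ⟨C, hC⟩, hM⟩ := hf
  obtain ⟨D⟩ := nonempty_numbering M
  -- The first two summands leave room for the work tapes, `D.nQ` for the states, and `1` for the
  -- position of the input head.
  set e := D.g * C + D.g * (C + 1) + D.nQ + 1 with he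
  refine ⟨fun y => instanceWord D e y, logspaceComputable_instanceWord D e, fun x k => ?_⟩
  obtain ⟨T, hT, hfx⟩ := hM x
  set y := pairWord x k with hy
  have hl : y.length = x.length + k := by simp [hy, pairWord]
  have h1 : y.length + 2 ≤ base e y := Nat.le_self_pow (by omega) _
  have h2 : D.nQ < base e y :=
    calc D.nQ < 2 ^ D.nQ := Nat.lt_two_pow_self
      _ ≤ (y.length + 2) ^ D.nQ := Nat.pow_le_pow_left (by omega) _
      _ ≤ base e y := Nat.pow_le_pow_right (by omega) (by omega)
  have h3 : D.nQ < dim e y M := h2.trans_le (Nat.le_self_pow (by omega) _)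
  refine ⟨reduction D e y h3, encode_instance D e y h3, ?_, ?_⟩
  · intro A hA
    obtain ⟨a, ha, rfl⟩ := Branching.exists_of_mem_matrices hA
    exact Branching.treewidthLE_rowMatrix ha _ _
  · have hprod := prod_matrices_eq (D := D) (k := k) (hC x) (pow_le_base D.g C e x k (by omega))
      (by omega : x.length + 1 < base e y) h2 hT (dim_pos e y) h3
    rw [← hfx] at hprod
    change ratBit ((Branching.matrices (dim e y M) D.nQ (weight D (base e y) y)).prod
      ⟨0, dim_pos e y⟩ ⟨D.nQ, h3⟩) (2 * numNone y - 1) = _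
    refine (congrArg (fun q => ratBit q (2 * numNone y - 1)) hprod).trans ?_
    rw [hy, numNone_pairWord]
    exact ratBit_intCast _ _
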